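/- Secluded Long Path is the following problem. Input: a finite simple undirected graph $G$, given by its adjacency matrix, a weight function $\omega\colon V(G)\to\mathbb{Z}_{>0}$, a nonnegative integer $t$ and a positive integer $w$. Question: does $G$ contain a $t$-secluded induced path of weight at least $w$, that is, a set $P\subseteq V(G)$ such that $G[P]$ is a path with at least one vertex, $|N_G(P)|\le t$ where $N_G(P)=\big(\bigcup_{v\in P}N_G(v)\big)\setminus P$, and $\sum_{v\in P}\omega(v)\ge w$? Theorem. Secluded Long Path can be solved in time $2^{\mathcal{O}(t\log t)}\cdot n^{\mathcal{O}(1)}$, where $n=|V(G)|$. More precisely, there are a single program for a random access machine (registers and finitely many arrays of natural numbers; each assignment, addition, truncated subtraction, indirect read or write, and test for zero costs one step; no multiplication), a function $g\colon\mathbb{N}\to\mathbb{R}$ with $g(t)=\mathcal{O}(t\log t)$ as $t\to\infty$, and a constant $k$ such that on every input $(G,\omega,t,w)$ the program halts after at most $2^{g(t)}\cdot(n+1)^{k}$ steps, correctly answers the question and, if the answer is yes, also outputs the vertex set of a $t$-secluded induced path of weight at least $w$. -/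

import Mathlib

/-! ### Graph notions -/

/-- The open neighbourhood `N_G(U)`: the vertices outside `U` with a neighbour in `U`. -/
def openNbhd {V : Type*} (G : SimpleGraph V) (U : Set V) : Set V :=
  {v | v ∉ U ∧ ∃ u ∈ U, G.Adj u v}

/-- `U` is `t`-secluded in the finite graph `G`: `|N_G(U)| ≤ t`. -/
def IsSecluded {V : Type*} (G : SimpleGraph V) (t : ℕ) (U : Set V) : Prop :=
  (openNbhd G U).ncard ≤ t

/-- `G[U]` is a path (with at least one vertex). -/
def IsInducedPath {V : Type*} (G : SimpleGraph V) (U : Set V) : Prop :=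
  ∃ k : ℕ, Nonempty (G.induce U ≃g SimpleGraph.pathGraph (k + 1))

open Classical in
/-- `U` is the vertex set of a `t`-secluded induced path of weight at least `w`. -/
def IsSecludedLongPath {n : ℕ} (G : SimpleGraph (Fin n)) (ω : Fin n → ℕ) (t w : ℕ)
    (U : Set (Fin n)) : Prop :=
  IsInducedPath G U ∧ IsSecluded G t U ∧ w ≤ ∑ v ∈ Finset.univ.filter (· ∈ U), ω v

/-! ### The machine model: a random access machine with unit cost

A memory state consists of registers and of one-dimensional arrays, all holding natural
numbers; a program text mentions only finitely many registers and arrays. The arithmetic is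
addition and truncated subtraction only, so that each step increases the maximal bit length of
the stored numbers by at most one (apart from the constants in the program text). -/

/-- Memory states of the machine. -/
structure RamState where
  reg : ℕ → ℕ
  arr : ℕ → ℕ → ℕ

/-- The elementary instructions. -/
inductive RamInstr where
  /-- `x := c`, for a constant `c`. -/
  | const (x c : ℕ)
  /-- `x := y`. -/
  | move (x y : ℕ)
  /-- `x := y + z`. -/
  | add (x y z : ℕ)
  /-- `x := max (y - z) 0`. -/
  | sub (x y z : ℕ)
  /-- `x := a[i]`, where `i` is the content of register `i`. -/
  | load (x a i : ℕ)
  /-- `a[i] := x`, where `i` is the content of register `i`. -/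
  | store (a i x : ℕ)

/-- The effect of an elementary instruction. -/
def RamInstr.apply (s : RamState) : RamInstr → RamState
  | .const x c => ⟨Function.update s.reg x c, s.arr⟩
  | .move x y => ⟨Function.update s.reg x (s.reg y), s.arr⟩
  | .add x y z => ⟨Function.update s.reg x (s.reg y + s.reg z), s.arr⟩
  | .sub x y z => ⟨Function.update s.reg x (s.reg y - s.reg z), s.arr⟩
  | .load x a i => ⟨Function.update s.reg x (s.arr a (s.reg i)), s.arr⟩
  | .store a i x =>
      ⟨s.reg, Function.update s.arr a (Function.update (s.arr a) (s.reg i) (s.reg x))⟩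

/-- Programs, in structured form. -/
inductive RamProg where
  /-- a single instruction -/
  | instr (c : RamInstr)
  /-- `p; q` -/
  | seq (p q : RamProg)
  /-- `if x ≠ 0 then p else q` -/
  | cond (x : ℕ) (p q : RamProg)
  /-- `while x ≠ 0 do p` -/
  | loop (x : ℕ) (p : RamProg)

/-- `RamExec p s T s'`: started in `s`, the program `p` halts in `s'` after exactly `T` steps.
Every elementary instruction and every evaluation of a test counts as one step. -/
inductive RamExec : RamProg → RamState → ℕ → RamState → Prop where
  | instr (c : RamInstr) (s : RamState) : RamExec (.instr c) s 1 (c.apply s)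
  | seq {p q : RamProg} {s s' s'' : RamState} {T T' : ℕ} :
      RamExec p s T s' → RamExec q s' T' s'' → RamExec (.seq p q) s (T + T') s''
  | cond_true {x : ℕ} {p q : RamProg} {s s' : RamState} {T : ℕ} :
      s.reg x ≠ 0 → RamExec p s T s' → RamExec (.cond x p q) s (T + 1) s'
  | cond_false {x : ℕ} {p q : RamProg} {s s' : RamState} {T : ℕ} :
      s.reg x = 0 → RamExec q s T s' → RamExec (.cond x p q) s (T + 1) s'
  | loop_done {x : ℕ} {p : RamProg} {s : RamState} :
      s.reg x = 0 → RamExec (.loop x p) s 1 s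
  | loop_step {x : ℕ} {p : RamProg} {s s' s'' : RamState} {T T' : ℕ} :
      s.reg x ≠ 0 → RamExec p s T s' → RamExec (.loop x p) s' T' s'' →
        RamExec (.loop x p) s (T + T' + 1) s''

/-- The machine is deterministic: running time and final state are unique. -/
theorem RamExec.deterministic {p : RamProg} {s s₁ s₂ : RamState} {T₁ T₂ : ℕ}
    (h₁ : RamExec p s T₁ s₁) (h₂ : RamExec p s T₂ s₂) : T₁ = T₂ ∧ s₁ = s₂ := by
  induction h₁ generalizing T₂ s₂ with
  | instr c s => cases h₂; exact ⟨rfl, rfl⟩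
  | seq _ _ ih ih' =>
    cases h₂ with
    | seq a b => obtain ⟨rfl, rfl⟩ := ih a; obtain ⟨rfl, rfl⟩ := ih' b; exact ⟨rfl, rfl⟩
  | cond_true hx _ ih =>
    cases h₂ with
    | cond_true _ a => obtain ⟨rfl, rfl⟩ := ih a; exact ⟨rfl, rfl⟩
    | cond_false h _ => exact absurd h hx
  | cond_false hx _ ih =>
    cases h₂ with
    | cond_true h _ => exact absurd hx h
    | cond_false _ a => obtain ⟨rfl, rfl⟩ := ih a; exact ⟨rfl, rfl⟩
  | loop_done hx =>
    cases h₂ with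
    | loop_done _ => exact ⟨rfl, rfl⟩
    | loop_step h _ _ => exact absurd hx h
  | loop_step hx _ _ ih ih' =>
    cases h₂ with
    | loop_done h => exact absurd h hx
    | loop_step _ a b => obtain ⟨rfl, rfl⟩ := ih a; obtain ⟨rfl, rfl⟩ := ih' b; exact ⟨rfl, rfl⟩

/-! ### Input and output -/

open Classical in
/-- The initial state on input `(G, ω, t, w)`, where `G` has the vertices `0, …, n - 1`:
registers `0, 1, 2` hold `n, t, w`, array `0` holds the weights, array `1` holds the adjacency
matrix row by row, and everything else is zero. -/
noncomputable def inputState {n : ℕ} (G : SimpleGraph (Fin n)) (ω : Fin n → ℕ) (t w : ℕ) :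
    RamState where
  reg x := if x = 0 then n else if x = 1 then t else if x = 2 then w else 0
  arr a i :=
    if a = 0 then (if h : i < n then ω ⟨i, h⟩ else 0)
    else if a = 1 then
      (if ∃ u v : Fin n, i = (u : ℕ) * n + (v : ℕ) ∧ G.Adj u v then 1 else 0)
    else 0

/-- The vertex set that a final state describes: array `2` holds its characteristic vector. -/
def outputSet (n : ℕ) (s : RamState) : Set (Fin n) :=
  {v | s.arr 2 (v : ℕ) = 1}

/-- The final state `s` is a correct answer to `(G, ω, t, w)`: either register `0` holds `1`
("yes") and the output is a `t`-secluded induced path of weight at least `w`, or register `0`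
holds `0` ("no") and there is no such path. -/
def IsCorrectAnswer {n : ℕ} (G : SimpleGraph (Fin n)) (ω : Fin n → ℕ) (t w : ℕ)
    (s : RamState) : Prop :=
  (s.reg 0 = 1 ∧ IsSecludedLongPath G ω t w (outputSet n s)) ∨
    (s.reg 0 = 0 ∧ ¬ ∃ U : Set (Fin n), IsSecludedLongPath G ω t w U)

/-! The algorithm grows an induced path from a guessed end vertex and guesses each branching. For an
induced path `f 0, …, f i`, let the boundary `bnd` consist of the outside neighbours of `f 0, …, f
(i - 1)`, and let `cand` consist of the remaining outside neighbours of `f i`. The path can be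
extended exactly by the candidates, since a boundary vertex would create a chord, and the open
neighbourhood is the disjoint union of the two sets (`openNbhd_pre`). Choosing one candidate sends
all the others into the boundary, whose size thus grows by `|cand| - 1` (`card_bnd_succ`), and
boundary vertices never return to the path.

Along a `t`-secluded path the boundary size is therefore nondecreasing, at most `t`, and strictly
increasing at every step with at least two candidates. So there are at most `t` genuine choices,
they occur at distinct boundary sizes below `t`, and each is among at most `t + 1` candidates.
Reading the choice at boundary size `j` from the `j`-th digit of a number `x < (t + 1) ^ t` in base
`t + 1` captures every solution (`IsPathSeq.exists_follows`). Forced steps have a single candidate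
and read a digit without effect.

The program tries all `x` and all start vertices. For a fixed pair the growth is deterministic and
takes at most `n` rounds of `O(n)` steps (`runs_stepBody`, `runs_runProg`). A base `t + 1` counter
enumerates the digits (`runs_incProg`). The total time is `O((n + 1) ^ 3 * (t + 1) ^ (t + 1))`, and
`(t + 1) ^ (t + 1)` is `2 ^ O(t log t)`. -/

/-! ### Executions with a time bound and a postcondition -/

/-- Started in `s`, the program `p` halts after at most `T` steps in a state satisfying `Q`. -/
def Runs (p : RamProg) (s : RamState) (T : ℕ) (Q : RamState → Prop) : Prop :=
  ∃ T' s', T' ≤ T ∧ RamExec p s T' s' ∧ Q s'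

theorem Runs.mono {p : RamProg} {s : RamState} {T T' : ℕ} {Q Q' : RamState → Prop}
    (h : Runs p s T Q) (hT : T ≤ T') (hQ : ∀ s', Q s' → Q' s') : Runs p s T' Q' := by
  obtain ⟨T₁, s', h₁, h₂, h₃⟩ := h
  exact ⟨T₁, s', h₁.trans hT, h₂, hQ _ h₃⟩

theorem Runs.seq {p q : RamProg} {s : RamState} {T₁ T₂ T : ℕ} {Q R : RamState → Prop}
    (hp : Runs p s T₁ Q) (hT : T₁ + T₂ ≤ T) (hq : ∀ s', Q s' → Runs q s' T₂ R) :
    Runs (.seq p q) s T R := by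
  obtain ⟨t₁, s₁, h₁, e₁, q₁⟩ := hp
  obtain ⟨t₂, s₂, h₂, e₂, q₂⟩ := hq _ q₁
  exact ⟨t₁ + t₂, s₂, by omega, .seq e₁ e₂, q₂⟩

theorem Runs.cond {x : ℕ} {p q : RamProg} {s : RamState} {T : ℕ} {Q : RamState → Prop}
    (hp : s.reg x ≠ 0 → Runs p s T Q) (hq : s.reg x = 0 → Runs q s T Q) :
    Runs (.cond x p q) s (T + 1) Q := by
  by_cases hx : s.reg x = 0
  · obtain ⟨t₁, s₁, h₁, e₁, q₁⟩ := hq hx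
    exact ⟨t₁ + 1, s₁, by omega, .cond_false hx e₁, q₁⟩
  · obtain ⟨t₁, s₁, h₁, e₁, q₁⟩ := hp hx
    exact ⟨t₁ + 1, s₁, by omega, .cond_true hx e₁, q₁⟩

/-- The index of `I` is a ghost counter that need not be stored in memory; it only bounds the number
of rounds by `N`. In the last round `x + 1 < N` fails, so the body has to stop the loop. -/
theorem Runs.while {r N c : ℕ} {body : RamProg} {I : ℕ → RamState → Prop}
    {Q : RamState → Prop}
    (hb : ∀ x < N, ∀ s, I x s → s.reg r ≠ 0 ∧ Runs body s c (fun s' =>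
      (x + 1 < N ∧ I (x + 1) s') ∨ (s'.reg r = 0 ∧ Q s')))
    {s : RamState} (hN : 0 < N) (h0 : I 0 s) : Runs (.loop r body) s (N * (c + 1) + 1) Q := by
  have key : ∀ m x s, x + m + 1 = N → I x s →
      Runs (.loop r body) s ((m + 1) * (c + 1) + 1) Q := by
    intro m
    induction m with
    | zero =>
      intro x s hx hs
      obtain ⟨hr, T₁, s₁, hT, e₁, ⟨h, -⟩ | ⟨h, hQ⟩⟩ := hb x (by omega) s hs
      · omega
      · exact ⟨_, s₁, by omega, .loop_step hr e₁ (.loop_done h), hQ⟩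
    | succ m ih =>
      intro x s hx hs
      obtain ⟨hr, T₁, s₁, hT, e₁, ⟨-, h⟩ | ⟨h, hQ⟩⟩ := hb x (by omega) s hs
      · obtain ⟨T₂, s₂, hT₂, e₂, hQ⟩ := ih (x + 1) s₁ (by omega) h
        refine ⟨_, s₂, ?_, .loop_step hr e₁ e₂, hQ⟩
        have : (m + 1 + 1) * (c + 1) = (m + 1) * (c + 1) + (c + 1) := by ring
        omega
      · refine ⟨_, s₁, ?_, .loop_step hr e₁ (.loop_done h), hQ⟩
        have : (m + 1 + 1) * (c + 1) = (m + 1) * (c + 1) + (c + 1) := by ring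
        omega
  obtain ⟨m, rfl⟩ : ∃ m, N = m + 1 := ⟨N - 1, by omega⟩
  exact key m 0 s (by omega) h0

/-! ### Programs without loops -/

/-- The effect of a program without loops. -/
def RamProg.eval : RamProg → RamState → RamState
  | .instr c, s => c.apply s
  | .seq p q, s => q.eval (p.eval s)
  | .cond x p q, s => if s.reg x = 0 then q.eval s else p.eval s
  | .loop _ _, s => s

/-- A bound for the running time of a program without loops. -/
def RamProg.cost : RamProg → ℕ
  | .instr _ => 1
  | .seq p q => p.cost + q.cost
  | .cond _ p q => max p.cost q.cost + 1
  | .loop _ _ => 0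

/-- Whether a program has no loops. -/
def RamProg.loopFree : RamProg → Bool
  | .instr _ => true
  | .seq p q => p.loopFree && q.loopFree
  | .cond _ p q => p.loopFree && q.loopFree
  | .loop _ _ => false

/-- Loop-free code can thus be verified by simplifying `eval` and computing `cost`. The hypothesis
`hp` excludes loops, where both functions have meaningless default values. -/
theorem runs_eval (p : RamProg) (hp : p.loopFree = true) (s : RamState) :
    Runs p s p.cost (· = p.eval s) := by
  induction p generalizing s with
  | instr c => exact ⟨1, _, le_rfl, .instr c s, rfl⟩
  | seq p q ihp ihq =>
    simp only [RamProg.loopFree, Bool.and_eq_true] at hp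
    exact (ihp hp.1 s).seq le_rfl (by rintro _ rfl; exact ihq hp.2 _)
  | cond x p q ihp ihq =>
    simp only [RamProg.loopFree, Bool.and_eq_true] at hp
    refine Runs.cond (fun h => ?_) (fun h => ?_)
    · exact (ihp hp.1 s).mono (le_max_left _ _) (by rintro _ rfl; simp [RamProg.eval, h])
    · exact (ihq hp.2 s).mono (le_max_right _ _) (by rintro _ rfl; simp [RamProg.eval, h])
  | loop x p => simp [RamProg.loopFree] at hp

theorem Runs.of_eval {p : RamProg} {s : RamState} {T : ℕ} {Q : RamState → Prop}
    (hp : p.loopFree = true) (hT : p.cost ≤ T) (hQ : Q (p.eval s)) : Runs p s T Q :=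
  (runs_eval p hp s).mono hT (by rintro _ rfl; exact hQ)

/-- The registers that a program may change (`x := x` is used as a no-operation). -/
def RamProg.writes : RamProg → List ℕ
  | .instr (.move x y) => if x = y then [] else [x]
  | .instr (.const x _) | .instr (.add x _ _) | .instr (.sub x _ _)
  | .instr (.load x _ _) => [x]
  | .instr (.store _ _ _) => []
  | .seq p q => p.writes ++ q.writes
  | .cond _ p q => p.writes ++ q.writes
  | .loop _ p => p.writes

/-- For a concrete program the premise on `writes` is decidable, so frame conditions follow by
`decide`. -/
theorem RamProg.eval_reg_of_lt {p : RamProg} {L r : ℕ} (hp : ∀ x ∈ p.writes, L ≤ x)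
    (hr : r < L) (s : RamState) : (p.eval s).reg r = s.reg r := by
  induction p generalizing s with
  | instr c =>
    cases c with
    | store a i x => rfl
    | move x y =>
      by_cases h : x = y
      · simp [RamProg.eval, RamInstr.apply, h]
      · simp only [RamProg.writes, h, if_false, List.mem_singleton, forall_eq] at hp
        exact Function.update_of_ne (by omega) _ _
    | _ =>
      simp only [RamProg.writes, List.mem_singleton, forall_eq] at hp
      exact Function.update_of_ne (by omega) _ _
  | seq p q ihp ihq =>
    simp only [RamProg.writes, List.mem_append] at hp
    rw [RamProg.eval, ihq fun x h => hp x (.inr h), ihp fun x h => hp x (.inl h)]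
  | cond x p q ihp ihq =>
    simp only [RamProg.writes, List.mem_append] at hp
    rw [RamProg.eval]
    split_ifs
    · exact ihq (fun x h => hp x (.inr h)) s
    · exact ihp (fun x h => hp x (.inl h)) s
  | loop x p => rfl

/-- A sequence of elementary instructions. -/
def RamProg.block : List RamInstr → RamProg
  | [] => .instr (.move 0 0)
  | c :: l => .seq (.instr c) (block l)

@[simp] theorem RamProg.eval_block_nil (s : RamState) : (RamProg.block []).eval s = s := by
  simp [RamProg.block, RamProg.eval, RamInstr.apply]

@[simp] theorem RamProg.eval_block_cons (c : RamInstr) (l : List RamInstr) (s : RamState) :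
    (RamProg.block (c :: l)).eval s = (RamProg.block l).eval (c.apply s) := rfl

theorem RamProg.loopFree_block (l : List RamInstr) : (RamProg.block l).loopFree = true := by
  induction l with
  | nil => rfl
  | cons c l ih => simp [RamProg.block, RamProg.loopFree, ih]

theorem RamProg.cost_block (l : List RamInstr) : (RamProg.block l).cost = l.length + 1 := by
  induction l with
  | nil => rfl
  | cons c l ih => simp [RamProg.block, RamProg.cost, ih]; omega

theorem Runs.block {l : List RamInstr} {s : RamState} {T : ℕ} {Q : RamState → Prop}
    (hT : l.length + 1 ≤ T) (hQ : Q ((RamProg.block l).eval s)) : Runs (.block l) s T Q :=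
  .of_eval (RamProg.loopFree_block l) ((RamProg.cost_block l).trans_le hT) hQ

/-! ### Counting loops -/

/-- `for L := 0 to lim - 1 do body`, where `L + 1` holds `L` times the content of register `0`,
register `L + 2` is the number of remaining rounds, and register `3` is supposed to hold `1`. -/
def forLoop (lim L : ℕ) (body : RamProg) : RamProg :=
  .seq (.block [.const L 0, .const (L + 1) 0, .move (L + 2) lim])
    (.loop (L + 2) (.seq body
      (.block [.add L L 3, .add (L + 1) (L + 1) 0, .sub (L + 2) (L + 2) 3])))

/-- Registers are layered: a loop at `L` owns `L`, `L + 1`, `L + 2`, and its body may change only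
registers from `L + 3` on. Condition `hI` says that the invariant ignores the registers below `L +
3`, so it survives the counter update. Each round costs `c`, plus 4 for the update block and 1 for
the test; initialisation and the final test cost 5. -/
theorem runs_forLoop {lim L N c : ℕ} {body : RamProg} {s : RamState}
    {I : ℕ → RamState → Prop} (hlim : lim < L) (hL : 3 < L) (hN : s.reg lim = N)
    (h1 : s.reg 3 = 1)
    (hI : ∀ k s₁ s₂, s₂.arr = s₁.arr → (∀ r, L + 3 ≤ r → s₂.reg r = s₁.reg r) →
      I k s₁ → I k s₂)
    (h0 : I 0 s)
    (hb : ∀ k < N, ∀ s₁, (∀ r < L, s₁.reg r = s.reg r) → s₁.reg L = k →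
      s₁.reg (L + 1) = k * s.reg 0 → I k s₁ →
      Runs body s₁ c (fun s₂ => (∀ r < L + 3, s₂.reg r = s₁.reg r) ∧ I (k + 1) s₂)) :
    Runs (forLoop lim L body) s (N * (c + 5) + 5)
      (fun s' => (∀ r < L, s'.reg r = s.reg r) ∧ I N s') := by
  have key : ∀ m k s₁, k + m = N → (∀ r < L, s₁.reg r = s.reg r) → s₁.reg L = k →
      s₁.reg (L + 1) = k * s.reg 0 → s₁.reg (L + 2) = m → I k s₁ →
      Runs (.loop (L + 2) (.seq body
        (.block [.add L L 3, .add (L + 1) (L + 1) 0, .sub (L + 2) (L + 2) 3]))) s₁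
        (m * (c + 5) + 1) (fun s' => (∀ r < L, s'.reg r = s.reg r) ∧ I N s') := by
    intro m
    induction m with
    | zero =>
      intro k s₁ hk hr _ _ h2 hs
      obtain rfl : k = N := by omega
      exact ⟨1, s₁, by omega, .loop_done h2, hr, hs⟩
    | succ m ih =>
      intro k s₁ hk hr hi ho h2 hs
      have hbody := (hb k (by omega) s₁ hr hi ho hs).seq
        (q := .block [.add L L 3, .add (L + 1) (L + 1) 0, .sub (L + 2) (L + 2) 3])
        (R := fun s₃ => (∀ r < L, s₃.reg r = s.reg r) ∧ s₃.reg L = k + 1 ∧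
          s₃.reg (L + 1) = (k + 1) * s.reg 0 ∧ s₃.reg (L + 2) = m ∧ I (k + 1) s₃)
        (T₂ := 4) le_rfl (by
          rintro s₂ ⟨hf, hs₂⟩
          refine .block le_rfl ?_
          have e0 := (hf 0 (by omega)).trans (hr 0 (by omega))
          have e3 := ((hf 3 (by omega)).trans (hr 3 (by omega))).trans h1
          have eL := (hf L (by omega)).trans hi
          have eL1 := (hf (L + 1) (by omega)).trans ho
          have eL2 := (hf (L + 2) (by omega)).trans h2
          refine ⟨fun r h => ?_, ?_, ?_, ?_, ?_⟩
          · simp [RamInstr.apply, Function.update_apply, show r ≠ L by omega,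
              show r ≠ L + 1 by omega, show r ≠ L + 2 by omega, hf r (by omega), hr r h]
          · simp [RamInstr.apply, Function.update_apply, eL, e3]
          · simp [RamInstr.apply, Function.update_apply, eL1, e0,
              show (0 : ℕ) ≠ L by omega]
            ring
          · simp [RamInstr.apply, Function.update_apply, eL2, e3, show (3 : ℕ) ≠ L by omega,
              show (3 : ℕ) ≠ L + 1 by omega]
          · refine hI _ s₂ _ rfl (fun r h => ?_) hs₂
            simp [RamInstr.apply, Function.update_apply, show r ≠ L by omega,
              show r ≠ L + 1 by omega, show r ≠ L + 2 by omega])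
      obtain ⟨T₁, s₃, hT₁, e₁, h₁, h₂, h₃, h₄, h₅⟩ := hbody
      obtain ⟨T₂, s₄, hT₂, e₂, hQ⟩ := ih (k + 1) s₃ (by omega) h₁ h₂ h₃ h₄ h₅
      refine ⟨_, s₄, ?_, .loop_step (by omega) e₁ e₂, hQ⟩
      have : (m + 1) * (c + 5) = m * (c + 5) + (c + 5) := by ring
      omega
  refine Runs.seq (T₁ := 4) (T₂ := N * (c + 5) + 1) (Q := fun s₁ =>
    (∀ r < L, s₁.reg r = s.reg r) ∧ s₁.reg L = 0 ∧ s₁.reg (L + 1) = 0 ∧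
      s₁.reg (L + 2) = N ∧ I 0 s₁) (.block le_rfl ?_) (by omega) ?_
  · refine ⟨fun r h => ?_, ?_, ?_, ?_, ?_⟩
    · simp [RamInstr.apply, Function.update_apply, show r ≠ L by omega,
        show r ≠ L + 1 by omega, show r ≠ L + 2 by omega]
    · simp [RamInstr.apply, Function.update_apply]
    · simp [RamInstr.apply, Function.update_apply]
    · simp [RamInstr.apply, hN, show lim ≠ L by omega,
        show lim ≠ L + 1 by omega]
    · refine hI _ s _ rfl (fun r h => ?_) h0
      simp [RamInstr.apply, Function.update_apply, show r ≠ L by omega,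
        show r ≠ L + 1 by omega, show r ≠ L + 2 by omega]
  · rintro s₁ ⟨h₁, h₂, h₃, h₄, h₅⟩
    exact key N 0 s₁ (by omega) h₁ h₂ (by simpa using h₃) h₄ h₅

/-! ### Induced paths as sequences of vertices -/

section PathSequences

open Classical

variable {n : ℕ} (G : SimpleGraph (Fin n)) (f : ℕ → Fin n)

/-- `f 0, …, f k` are the consecutive vertices of an induced path. -/
def IsPathSeq (k : ℕ) : Prop :=
  (∀ i ≤ k, ∀ j ≤ k, f i = f j → i = j) ∧
    ∀ i ≤ k, ∀ j ≤ k, (G.Adj (f i) (f j) ↔ i + 1 = j ∨ j + 1 = i)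

/-- The vertices `f 0, …, f i`. -/
noncomputable def pre (i : ℕ) : Finset (Fin n) := (Finset.range (i + 1)).image f

/-- The vertices outside `f 0, …, f i` with a neighbour among `f 0, …, f (i - 1)`. -/
noncomputable def bnd (i : ℕ) : Finset (Fin n) :=
  Finset.univ.filter fun u => u ∉ pre f i ∧ ∃ j < i, G.Adj (f j) u

/-- The vertices by which the induced path `f 0, …, f i` can be extended. -/
noncomputable def cand (i : ℕ) : Finset (Fin n) :=
  Finset.univ.filter fun u => u ∉ pre f i ∧ u ∉ bnd G f i ∧ G.Adj (f i) u

/-- The number of elements of `S` below `u`. -/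
def rank (S : Finset (Fin n)) (u : Fin n) : ℕ := (S.filter (· < u)).card

variable {G f}

theorem mem_pre {i : ℕ} {u : Fin n} : u ∈ pre f i ↔ ∃ j ≤ i, f j = u := by
  simp [pre]

theorem mem_bnd {i : ℕ} {u : Fin n} :
    u ∈ bnd G f i ↔ u ∉ pre f i ∧ ∃ j < i, G.Adj (f j) u := by
  simp [bnd]

theorem mem_cand {i : ℕ} {u : Fin n} :
    u ∈ cand G f i ↔ u ∉ pre f i ∧ u ∉ bnd G f i ∧ G.Adj (f i) u := by
  simp [cand]

theorem pre_congr {f' : ℕ → Fin n} {i : ℕ} (h : ∀ j ≤ i, f' j = f j) :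
    pre f' i = pre f i := by
  ext u
  simp only [mem_pre]
  exact exists_congr fun j => and_congr_right fun hj => by rw [h j hj]

theorem bnd_congr {f' : ℕ → Fin n} {i : ℕ} (h : ∀ j ≤ i, f' j = f j) :
    bnd G f' i = bnd G f i := by
  ext u
  simp only [mem_bnd, pre_congr h]
  exact and_congr_right fun _ => exists_congr fun j => and_congr_right fun hj => by
    rw [h j hj.le]

theorem cand_congr {f' : ℕ → Fin n} {i : ℕ} (h : ∀ j ≤ i, f' j = f j) :
    cand G f' i = cand G f i := by
  ext u
  simp only [mem_cand, pre_congr h, bnd_congr h, h i le_rfl]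

theorem IsPathSeq.congr {f' : ℕ → Fin n} {k : ℕ} (hf : IsPathSeq G f k)
    (h : ∀ j ≤ k, f' j = f j) : IsPathSeq G f' k := by
  refine ⟨fun i hi j hj => ?_, fun i hi j hj => ?_⟩
  · rw [h i hi, h j hj]; exact hf.1 i hi j hj
  · rw [h i hi, h j hj]; exact hf.2 i hi j hj

theorem IsPathSeq.le {k i : ℕ} (hf : IsPathSeq G f k) (h : i ≤ k) : IsPathSeq G f i :=
  ⟨fun a ha b hb => hf.1 a (ha.trans h) b (hb.trans h),
    fun a ha b hb => hf.2 a (ha.trans h) b (hb.trans h)⟩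

theorem isPathSeq_zero : IsPathSeq G f 0 := by
  refine ⟨fun i hi j hj _ => by omega, fun i hi j hj => ?_⟩
  obtain rfl : i = 0 := by omega
  obtain rfl : j = 0 := by omega
  simp

/-! ### Extending an induced path by one vertex. -/

theorem IsPathSeq.mem_cand {k i : ℕ} (hf : IsPathSeq G f k) (h : i < k) :
    f (i + 1) ∈ cand G f i := by
  refine _root_.mem_cand.2 ⟨?_, ?_, (hf.2 i h.le (i + 1) h).2 (.inl rfl)⟩
  · rw [mem_pre]
    rintro ⟨j, hj, e⟩
    have := hf.1 j (by omega) (i + 1) h e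
    omega
  · rw [mem_bnd]
    rintro ⟨-, j, hj, e⟩
    have := (hf.2 j (by omega) (i + 1) h).1 e
    omega

/-- A candidate lies outside the boundary, so its only neighbour on the path is the last vertex. -/
theorem IsPathSeq.succ {i : ℕ} (hf : IsPathSeq G f i) (h : f (i + 1) ∈ cand G f i) :
    IsPathSeq G f (i + 1) := by
  obtain ⟨h₁, h₂, h₃⟩ := _root_.mem_cand.1 h
  have hne : ∀ j ≤ i, f j ≠ f (i + 1) := fun j hj e => h₁ (mem_pre.2 ⟨j, hj, e⟩)
  have hadj : ∀ j ≤ i, (G.Adj (f j) (f (i + 1)) ↔ j = i) := by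
    intro j hj
    constructor
    · intro e
      by_contra hji
      exact h₂ (mem_bnd.2 ⟨h₁, j, by omega, e⟩)
    · rintro rfl; exact h₃
  constructor
  · intro a ha b hb e
    rcases Nat.le_succ_iff.1 ha with ha' | rfl <;> rcases Nat.le_succ_iff.1 hb with hb' | rfl
    · exact hf.1 a ha' b hb' e
    · exact absurd e (hne a ha')
    · exact absurd e.symm (hne b hb')
    · rfl
  · intro a ha b hb
    rcases Nat.le_succ_iff.1 ha with ha' | rfl <;> rcases Nat.le_succ_iff.1 hb with hb' | rfl
    · exact hf.2 a ha' b hb'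
    · rw [hadj a ha']; omega
    · rw [G.adj_comm, hadj b hb']; omega
    · simp

theorem pre_succ (i : ℕ) : pre f (i + 1) = insert (f (i + 1)) (pre f i) := by
  rw [pre, Finset.range_add_one, Finset.image_insert]; rfl

theorem bnd_succ {i : ℕ} (h : f (i + 1) ∈ cand G f i) :
    bnd G f (i + 1) = bnd G f i ∪ (cand G f i).erase (f (i + 1)) := by
  obtain ⟨-, h₂, -⟩ := mem_cand.1 h
  ext u
  simp only [Finset.mem_union, Finset.mem_erase, mem_cand]
  rw [mem_bnd, pre_succ, Finset.mem_insert]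
  constructor
  · rintro ⟨hu, j, hj, e⟩
    rw [not_or] at hu
    by_cases hb : u ∈ bnd G f i
    · exact .inl hb
    · refine .inr ⟨hu.1, hu.2, hb, ?_⟩
      rcases Nat.lt_succ_iff_lt_or_eq.1 hj with hj | rfl
      · exact absurd (mem_bnd.2 ⟨hu.2, j, hj, e⟩) hb
      · exact e
  · rintro (hu | ⟨h₁, h₂, h₃, h₄⟩)
    · obtain ⟨h₃, j, hj, e⟩ := mem_bnd.1 hu
      refine ⟨?_, j, by omega, e⟩
      rintro (rfl | h)
      · exact h₂ hu
      · exact h₃ h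
    · exact ⟨by tauto, i, by omega, h₄⟩

theorem disjoint_bnd_cand (i : ℕ) : Disjoint (bnd G f i) (cand G f i) :=
  Finset.disjoint_left.2 fun _ h h' => (mem_cand.1 h').2.1 h

theorem card_bnd_succ {i : ℕ} (h : f (i + 1) ∈ cand G f i) :
    (bnd G f (i + 1)).card = (bnd G f i).card + ((cand G f i).card - 1) := by
  rw [bnd_succ h, Finset.card_union_of_disjoint, Finset.card_erase_of_mem h]
  exact (disjoint_bnd_cand i).mono_right (Finset.erase_subset _ _)

theorem openNbhd_pre (i : ℕ) :
    openNbhd G (pre f i : Set (Fin n)) = (bnd G f i ∪ cand G f i : Finset (Fin n)) := by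
  ext u
  simp only [openNbhd, Set.mem_ofPred_eq, Finset.coe_union, Set.mem_union, Finset.mem_coe,
    mem_cand]
  constructor
  · rintro ⟨h, v, hv, e⟩
    obtain ⟨j, hj, rfl⟩ := mem_pre.1 hv
    by_cases hb : u ∈ bnd G f i
    · exact .inl hb
    · refine .inr ⟨h, hb, ?_⟩
      rcases hj.lt_or_eq with hj | rfl
      · exact absurd (mem_bnd.2 ⟨h, j, hj, e⟩) hb
      · exact e
  · rintro (h | ⟨h₁, -, h₃⟩)
    · obtain ⟨h₃, j, hj, e⟩ := mem_bnd.1 h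
      exact ⟨h₃, f j, mem_pre.2 ⟨j, hj.le, rfl⟩, e⟩
    · exact ⟨h₁, f i, mem_pre.2 ⟨i, le_rfl, rfl⟩, h₃⟩

theorem isSecluded_pre {i t : ℕ} :
    IsSecluded G t (pre f i : Set (Fin n)) ↔ (bnd G f i).card + (cand G f i).card ≤ t := by
  rw [IsSecluded, openNbhd_pre, Set.ncard_coe_finset,
    Finset.card_union_of_disjoint (disjoint_bnd_cand i)]

/-- A boundary vertex has a neighbour `f j` with `j < i`. If it appeared later on the path, its
index would be `j ± 1`, hence at most `i`. -/
theorem IsPathSeq.bnd_subset {k i : ℕ} (hf : IsPathSeq G f k) (h : i ≤ k) :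
    bnd G f i ⊆ bnd G f k := by
  intro u hu
  obtain ⟨h₁, j, hj, e⟩ := mem_bnd.1 hu
  refine mem_bnd.2 ⟨fun h₂ => ?_, j, by omega, e⟩
  obtain ⟨m, hm, rfl⟩ := mem_pre.1 h₂
  have h₃ : ¬ m ≤ i := fun h₃ => h₁ (mem_pre.2 ⟨m, h₃, rfl⟩)
  have := (hf.2 j (by omega) m hm).1 e
  omega

theorem IsPathSeq.lt {k : ℕ} (hf : IsPathSeq G f k) : k < n := by
  have h := Finset.card_le_univ (pre f k)
  rw [pre, Finset.card_image_of_injOn, Finset.card_range, Fintype.card_fin] at h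
  · exact h
  · intro a ha b hb e
    simp only [Finset.coe_range, Set.mem_Iio] at ha hb
    exact hf.1 a (by omega) b (by omega) e

theorem IsPathSeq.isInducedPath {k : ℕ} (hf : IsPathSeq G f k) :
    IsInducedPath G (pre f k : Set (Fin n)) := by
  let e : Fin (k + 1) → (pre f k : Set (Fin n)) :=
    fun i => ⟨f i, mem_pre.2 ⟨i, by omega, rfl⟩⟩
  have he : Function.Bijective e := by
    constructor
    · intro a b h
      exact Fin.ext (hf.1 a (by omega) b (by omega) (congrArg Subtype.val h))
    · rintro ⟨u, hu⟩
      obtain ⟨j, hj, rfl⟩ := mem_pre.1 hu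
      exact ⟨⟨j, by omega⟩, rfl⟩
  refine ⟨k, ⟨RelIso.symm ⟨Equiv.ofBijective e he, ?_⟩⟩⟩
  intro a b
  have := hf.2 a (by omega) b (by omega)
  simp only [Equiv.ofBijective_apply, SimpleGraph.comap_adj, SimpleGraph.pathGraph_adj, e]
  simpa using this

theorem IsInducedPath.exists_isPathSeq {U : Set (Fin n)} (h : IsInducedPath G U) :
    ∃ (f : ℕ → Fin n) (k : ℕ), IsPathSeq G f k ∧ U = pre f k := by
  obtain ⟨k, ⟨e⟩⟩ := h
  have hlt : ∀ i, min i k < k + 1 := fun i => by omega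
  -- Truncation at `k` makes the sequence total; the values beyond `k` are irrelevant.
  refine ⟨fun i => (e.symm ⟨min i k, hlt i⟩ : U), k, ⟨?_, ?_⟩, ?_⟩
  · intro i hi j hj h
    have := e.symm.injective (Subtype.ext h)
    simp only [Fin.mk.injEq] at this
    omega
  · intro i hi j hj
    have := e.symm.map_adj_iff (v := ⟨min i k, hlt i⟩) (w := ⟨min j k, hlt j⟩)
    rw [SimpleGraph.comap_adj] at this
    refine this.trans ?_
    rw [SimpleGraph.pathGraph_adj]
    simp only [min_eq_left hi, min_eq_left hj]
  · ext u
    simp only [Finset.mem_coe, mem_pre]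
    constructor
    · intro hu
      refine ⟨(e ⟨u, hu⟩ : Fin (k + 1)), by omega, ?_⟩
      have : (⟨min (e ⟨u, hu⟩ : ℕ) k, hlt _⟩ : Fin (k + 1)) = e ⟨u, hu⟩ :=
        Fin.ext (min_eq_left (by omega))
      rw [this]; simp
    · rintro ⟨j, -, rfl⟩
      exact Subtype.coe_prop _

/-! ### Ranks in a finite set of vertices. -/

theorem rank_lt_card {S : Finset (Fin n)} {u : Fin n} (h : u ∈ S) : rank S u < S.card :=
  Finset.card_lt_card (Finset.filter_ssubset.2 ⟨u, h, lt_irrefl _⟩)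

theorem rank_lt_rank {S : Finset (Fin n)} {u v : Fin n} (hu : u ∈ S) (h : u < v) :
    rank S u < rank S v := by
  refine Finset.card_lt_card (Finset.ssubset_iff_of_subset ?_ |>.2 ⟨u, ?_, ?_⟩)
  · intro x hx
    simp only [Finset.mem_filter] at hx ⊢
    exact ⟨hx.1, hx.2.trans h⟩
  · simp [hu, h]
  · simp

theorem rank_inj {S : Finset (Fin n)} {u v : Fin n} (hu : u ∈ S) (hv : v ∈ S)
    (h : rank S u = rank S v) : u = v := by
  rcases lt_trichotomy u v with h' | h' | h'
  · have := rank_lt_rank hu h'; omega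
  · exact h'
  · have := rank_lt_rank hv h'; omega

theorem exists_rank_eq {S : Finset (Fin n)} {d : ℕ} (h : d < S.card) :
    ∃ u ∈ S, rank S u = d := by
  have hinj : Set.InjOn (rank S) S := fun u hu v hv => rank_inj hu hv
  have himg : S.image (rank S) = Finset.range S.card := by
    refine Finset.eq_of_subset_of_card_le ?_ ?_
    · intro x hx
      obtain ⟨u, hu, rfl⟩ := Finset.mem_image.1 hx
      exact Finset.mem_range.2 (rank_lt_card hu)
    · rw [Finset.card_image_of_injOn hinj, Finset.card_range]
  exact Finset.mem_image.1 (himg ▸ Finset.mem_range.2 h)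

/-! ### Encoding a path by digits -/

variable (G f)

/-- The rank of the candidate that the digits `b` select after `f 0, …, f i`. -/
noncomputable def selectedRank (b : ℕ → ℕ) (i : ℕ) : ℕ :=
  min (b (bnd G f i).card) ((cand G f i).card - 1)

/-- The digits `b` select the vertices `f 1, …, f k`. -/
def Follows (b : ℕ → ℕ) (k : ℕ) : Prop :=
  ∀ i < k, rank (cand G f i) (f (i + 1)) = selectedRank G f b i

/-- The digits of `x` in base `B`. -/
def digit (B x i : ℕ) : ℕ := x / B ^ i % B

variable {G f}

/-- Steps with at least two candidates strictly enlarge the boundary, so no two of them compete for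
the same digit. Both the position and the value of the digit fit, because the boundary after the
step still has at most `t` elements. -/
theorem IsPathSeq.exists_follows {k t : ℕ} (hf : IsPathSeq G f k)
    (ht : IsSecluded G t (pre f k : Set (Fin n))) :
    ∃ x < (t + 1) ^ t, Follows G f (digit (t + 1) x) k := by
  rw [isSecluded_pre] at ht
  have hcard : ∀ i ≤ k, (bnd G f i).card ≤ t := fun i hi =>
    (Finset.card_le_card (hf.bnd_subset hi)).trans (by omega)
  have hstep : ∀ i < k, (bnd G f i).card + ((cand G f i).card - 1) ≤ t := fun i hi =>
    card_bnd_succ (hf.mem_cand hi) ▸ hcard (i + 1) hi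
  have hmono : ∀ i j, i < j → j ≤ k →
      (bnd G f i).card + ((cand G f i).card - 1) ≤ (bnd G f j).card := by
    intro i j hij hj
    rw [← card_bnd_succ (hf.mem_cand (by omega))]
    exact Finset.card_le_card ((hf.le hj).bnd_subset hij)
  have hrank : ∀ i < k, rank (cand G f i) (f (i + 1)) < (cand G f i).card := fun i hi =>
    rank_lt_card (hf.mem_cand hi)
  -- `p j i`: step `i` is a genuine choice made at boundary size `j`. At most one `i` exists for
  -- each `j`; positions without one receive the digit 0.
  let p : ℕ → ℕ → Prop := fun j i => i < k ∧ (bnd G f i).card = j ∧ 2 ≤ (cand G f i).card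
  let b : Fin t → Fin (t + 1) := fun j =>
    if h : ∃ i, p j i then
      ⟨rank (cand G f h.choose) (f (h.choose + 1)), by
        obtain ⟨h₁, -, -⟩ := h.choose_spec
        have := hrank _ h₁; have := hstep _ h₁; omega⟩
    else 0
  have hb : ∀ i (hi : i < k) (hc : 2 ≤ (cand G f i).card),
      (b ⟨(bnd G f i).card, by have := hstep i hi; omega⟩ : ℕ) =
        rank (cand G f i) (f (i + 1)) := by
    intro i hi hc
    have h : ∃ i', p (bnd G f i).card i' := ⟨i, hi, rfl, hc⟩
    have hch : h.choose = i := by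
      obtain ⟨h₁, h₂, h₃⟩ := h.choose_spec
      rcases lt_trichotomy h.choose i with h' | h' | h'
      · have := hmono _ _ h' hi.le; omega
      · exact h'
      · have := hmono _ _ h' h₁.le; omega
    simp only [b]
    rw [dif_pos h]
    simp only [hch]
  refine ⟨(finFunctionFinEquiv b : Fin ((t + 1) ^ t)), Fin.is_lt _, fun i hi => ?_⟩
  have h₁ := hrank i hi
  rw [selectedRank]
  by_cases hc : 2 ≤ (cand G f i).card
  · have hlt : (bnd G f i).card < t := by have := hstep i hi; omega
    have : digit (t + 1) (finFunctionFinEquiv b : Fin ((t + 1) ^ t)) (bnd G f i).card =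
        rank (cand G f i) (f (i + 1)) := by
      rw [← hb i hi hc]
      have := congrFun (finFunctionFinEquiv.symm_apply_apply b) ⟨(bnd G f i).card, hlt⟩
      exact congrArg Fin.val this
    rw [this, min_eq_left (by omega)]
  -- With a single candidate the rank is 0, and so is the minimum in `selectedRank`, whatever the
  -- digit.
  · omega

end PathSequences

/-! ### The program -/

namespace SecludedPathProg

open RamInstr RamProg

/-- Increment register `33` if the vertex in register `30` is adjacent to the current vertex and
unmarked. -/
def countBody : RamProg :=
  .seq (block [add 34 24 30, load 35 1 34, load 36 2 30])
    (.cond 35 (.cond 36 (block []) (block [add 33 33 3])) (block []))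

/-- Count the unmarked neighbours of the current vertex. -/
def countProg : RamProg := .seq (block [const 33 0]) (forLoop 0 30 countBody)

/-- Treat the vertex in register `30`: if it is an unmarked neighbour of the current vertex, then
mark it, by `1` if it is the one whose rank is given by register `37`, and by `2` otherwise. -/
def chooseBody : RamProg :=
  .seq (block [add 34 24 30, load 35 1 34, load 36 2 30])
    (.cond 35 (.cond 36 (block [])
      (.seq (block [sub 41 37 38, sub 42 38 37, add 41 41 42])
        (.cond 41 (block [const 42 2, store 2 30 42, add 38 38 3])
          (block [store 2 30 3, move 39 30, move 40 31, add 38 38 3])))) (block []))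

/-- Extend the current path by the neighbour that the current digit selects. -/
def extendProg : RamProg :=
  .seq (block [load 37 3 25, sub 38 33 3, sub 39 37 38, sub 37 37 39, const 38 0])
    (.seq (forLoop 0 30 chooseBody)
      (block [move 23 39, move 24 40, sub 34 33 3, add 25 25 34, load 35 0 39, add 26 26 35]))

/-- Test the current path and extend it. Registers `23`, …, `28` hold the last vertex, its row
offset in the adjacency matrix, the number of vertices marked by `2`, the weight of the path,
whether the path can be extended, and whether a solution has been found. -/
def stepBody : RamProg :=
  .cond 27
    (.seq countProg
      (.seq (block [add 34 25 33, sub 35 34 1, sub 36 2 26, add 35 35 36])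
        (.cond 35 (.cond 33 extendProg (block [const 27 0]))
          (block [const 27 0, const 28 1]))))
    (block [])

/-- Build the path that starts at the vertex in register `10` and follows the digits in array
`3`. -/
def runProg : RamProg :=
  .seq (forLoop 0 30 (block [const 33 0, store 2 30 33]))
    (.seq (block [store 2 10 3, move 23 10, move 24 11, const 25 0, load 26 0 10, const 27 1])
      (forLoop 0 20 stepBody))

/-- One round of the addition of `1` to the number with the digits in array `3`; register `33` is
the carry. -/
def incBody : RamProg :=
  .cond 33
    (.seq (block [load 34 3 20, sub 35 1 34])
      (.cond 35 (block [add 34 34 3, store 3 20 34, const 33 0])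
        (block [const 36 0, store 3 20 36])))
    (block [])

/-- Add `1` to the number with the digits in array `3`; register `5` is set to `0` if this
overflows. -/
def incProg : RamProg :=
  .seq (block [const 33 1]) (.seq (forLoop 1 20 incBody) (block [sub 5 3 33]))

/-- All start vertices for fixed digits. -/
def roundProg : RamProg :=
  .seq (forLoop 0 10 (.cond 28 (block []) runProg)) (.cond 28 (block [const 5 0]) incProg)

/-- The program for Secluded Long Path. -/
def mainProg : RamProg :=
  .seq (block [const 3 1, const 5 1]) (.seq (.loop 5 roundProg) (block [move 0 28]))

/-! ### Ranks and counting -/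

/-- The number of elements of `S` below the natural number `k`. -/
def cardLt {n : ℕ} (S : Finset (Fin n)) (k : ℕ) : ℕ := (S.filter fun u : Fin n => (u : ℕ) < k).card

variable {n : ℕ}

theorem cardLt_zero (S : Finset (Fin n)) : cardLt S 0 = 0 := by simp [cardLt]

theorem cardLt_self (S : Finset (Fin n)) : cardLt S n = S.card := by
  rw [cardLt, Finset.filter_true_of_mem fun u _ => u.2]

theorem cardLt_succ_of_mem {S : Finset (Fin n)} {u : Fin n} (h : u ∈ S) :
    cardLt S (u + 1) = cardLt S u + 1 := by
  rw [cardLt, cardLt, ← Finset.card_insert_of_notMem (a := u) (by simp)]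
  congr 1
  ext v
  simp only [Finset.mem_filter, Finset.mem_insert]
  constructor
  · rintro ⟨h₁, h₂⟩
    by_cases e : v = u
    · exact .inl e
    · refine .inr ⟨h₁, ?_⟩
      have : (v : ℕ) ≠ u := fun h => e (Fin.ext h)
      omega
  · rintro (rfl | ⟨h₁, h₂⟩)
    · exact ⟨h, by omega⟩
    · exact ⟨h₁, by omega⟩

theorem cardLt_succ_of_notMem {S : Finset (Fin n)} {u : Fin n} (h : u ∉ S) :
    cardLt S (u + 1) = cardLt S u := by
  rw [cardLt, cardLt]
  congr 1
  ext v
  simp only [Finset.mem_filter]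
  refine and_congr_right fun hv => ?_
  have : (v : ℕ) ≠ u := fun e => h (Fin.ext e ▸ hv)
  omega

/-! ### The inner loops -/

/-- `S` is the set of unmarked neighbours of the current vertex. -/
def IsCand (S : Finset (Fin n)) (s : RamState) : Prop :=
  ∀ u : Fin n, u ∈ S ↔ s.arr 1 (s.reg 24 + u) ≠ 0 ∧ s.arr 2 u = 0

theorem runs_countProg {S : Finset (Fin n)} {s : RamState} (h0 : s.reg 0 = n)
    (h3 : s.reg 3 = 1) (hS : IsCand S s) :
    Runs countProg s (13 * n + 7) (fun s' => (∀ r < 30, s'.reg r = s.reg r) ∧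
      s'.arr = s.arr ∧ s'.reg 33 = S.card) := by
  refine Runs.seq (T₁ := 2) (T₂ := n * (8 + 5) + 5) (Q := fun s₁ =>
    (∀ r < 30, s₁.reg r = s.reg r) ∧ s₁.arr = s.arr ∧ s₁.reg 33 = 0)
    (.block le_rfl ⟨fun r hr => ?_, ?_, ?_⟩) (by omega) ?_
  · simp [RamInstr.apply, show r ≠ 33 by omega]
  · simp [RamInstr.apply]
  · simp [RamInstr.apply]
  rintro s₁ ⟨hf, ha, h33⟩
  refine (runs_forLoop (N := n) (c := 8)
    (I := fun k s₂ => s₂.arr = s.arr ∧ s₂.reg 33 = cardLt S k)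
    (by norm_num) (by norm_num) ((hf 0 (by norm_num)).trans h0)
    ((hf 3 (by norm_num)).trans h3) ?_ ⟨ha, by rw [h33, cardLt_zero]⟩ ?_).mono le_rfl ?_
  · rintro k s₂ s₃ e hr ⟨h₁, h₂⟩
    exact ⟨e.trans h₁, (hr 33 (by norm_num)).trans h₂⟩
  · rintro k hk s₂ hr hi - ⟨e, hc⟩
    have h24 : s₂.reg 24 = s.reg 24 := (hr 24 (by norm_num)).trans (hf 24 (by norm_num))
    have h3' : s₂.reg 3 = 1 := ((hr 3 (by norm_num)).trans (hf 3 (by norm_num))).trans h3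
    have hu := hS ⟨k, hk⟩
    refine .of_eval rfl (by decide) ⟨fun r hr => ?_, ?_, ?_⟩
    · exact eval_reg_of_lt (by decide) hr _
    · simp only [countBody, RamProg.eval, eval_block_cons, eval_block_nil, RamInstr.apply]
      split_ifs <;> exact e
    · by_cases hm : (⟨k, hk⟩ : Fin n) ∈ S
      · obtain ⟨h₁, h₂⟩ := hu.1 hm
        rw [cardLt_succ_of_mem (u := ⟨k, hk⟩) hm]
        simp only [] at h₁ h₂
        simp [countBody, RamProg.eval, RamInstr.apply, h24, hi, e, h₁, h₂,
          h3', hc]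
      · rw [cardLt_succ_of_notMem (u := ⟨k, hk⟩) hm, ← hc]
        rw [hu] at hm
        simp only [countBody, RamProg.eval, eval_block_cons, eval_block_nil, RamInstr.apply]
        split_ifs with h₁ h₂
        · simp
        · exfalso
          simp [h24, hi, e] at h₁ h₂
          exact hm ⟨h₁, h₂⟩
        · simp
  · rintro s₂ ⟨hr, ha', h⟩
    exact ⟨fun r h => (hr r h).trans (hf r h), ha', h.trans (cardLt_self S)⟩

/-- Round `k` can change the mark of vertex `k` only, so the test in that round still sees the
original mark. Register `38` counts the candidates passed so far, which is the rank of vertex `k`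
when it is a candidate. -/
theorem runs_choose {S : Finset (Fin n)} {s : RamState} {d : ℕ} (h0 : s.reg 0 = n)
    (h3 : s.reg 3 = 1) (hS : IsCand S s) (hd : s.reg 37 = d) (h38 : s.reg 38 = 0) :
    Runs (forLoop 0 30 chooseBody) s (22 * n + 5) (fun s' => (∀ r < 30, s'.reg r = s.reg r) ∧
      (∀ a ≠ 2, s'.arr a = s.arr a) ∧ s'.reg 33 = s.reg 33 ∧
      (∀ u : Fin n, s'.arr 2 u =
        if u ∈ S then if rank S u = d then 1 else 2 else s.arr 2 u) ∧
      ∀ u ∈ S, rank S u = d → s'.reg 39 = u ∧ s'.reg 40 = u * n) := by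
  refine (runs_forLoop (N := n) (c := 17)
    (I := fun k s₂ => (∀ a ≠ 2, s₂.arr a = s.arr a) ∧ s₂.reg 33 = s.reg 33 ∧ s₂.reg 37 = d ∧
      s₂.reg 38 = cardLt S k ∧
      (∀ u : Fin n, s₂.arr 2 u =
        if u ∈ S ∧ (u : ℕ) < k then if rank S u = d then 1 else 2 else s.arr 2 u) ∧
      ∀ u ∈ S, (u : ℕ) < k → rank S u = d → s₂.reg 39 = u ∧ s₂.reg 40 = u * n)
    (by norm_num) (by norm_num) h0 h3 ?_ ⟨fun _ _ => rfl, rfl, hd, by rw [h38, cardLt_zero],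
      by simp, by simp⟩ ?_).mono (by omega) ?_
  · rintro k s₂ s₃ e hr ⟨h₁, h₂, h₃, h₄, h₅, h₆⟩
    rw [e, hr 33 (by norm_num), hr 37 (by norm_num), hr 38 (by norm_num), hr 39 (by norm_num),
      hr 40 (by norm_num)]
    exact ⟨h₁, h₂, h₃, h₄, h₅, h₆⟩
  · rintro k hk s₂ hr hi ho ⟨ha, h33, h37, hc, hm, hsel⟩
    have h24 : s₂.reg 24 = s.reg 24 := hr 24 (by norm_num)
    have h3' : s₂.reg 3 = 1 := (hr 3 (by norm_num)).trans h3
    have e1 : s₂.arr 1 = s.arr 1 := ha 1 (by norm_num)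
    have hu := hS ⟨k, hk⟩
    have hmk := hm ⟨k, hk⟩
    simp only [lt_irrefl, and_false, if_false] at hmk
    have hlt : ∀ u : Fin n, u ≠ ⟨k, hk⟩ → ((u : ℕ) < k + 1 ↔ (u : ℕ) < k) := by
      intro u hne
      have : (u : ℕ) ≠ k := fun h => hne (Fin.ext h)
      omega
    refine .of_eval rfl (by decide) ⟨fun r hr => ?_, ?_⟩
    · exact eval_reg_of_lt (by decide) hr _
    · by_cases hmem : (⟨k, hk⟩ : Fin n) ∈ S
      · obtain ⟨h₁, h₂⟩ := hu.1 hmem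
        simp only [] at h₁ h₂
        rw [cardLt_succ_of_mem (u := ⟨k, hk⟩) hmem]
        have hrk : rank S ⟨k, hk⟩ = cardLt S k := rfl
        have hne : ∀ u : Fin n, u ≠ ⟨k, hk⟩ → (u : ℕ) ≠ k := fun u h e => h (Fin.ext e)
        by_cases hd' : cardLt S k = d
        · simp [chooseBody, RamProg.eval, RamInstr.apply, h24, hi, e1, h₁, hmk, h₂, h3', hc, h37, hd', h33, ho, h0]
          refine ⟨fun a ha' => ?_, fun u => ?_, fun u huS hu' hrank => ?_⟩
          · simp [ha', ha]
          · by_cases e : u = ⟨k, hk⟩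
            · subst e
              simp [hmem, hrk, hd']
            · have := hne u e
              simp [this, show ((u : ℕ) ≤ k ↔ (u : ℕ) < k) by omega, hm u]
          · by_cases e : u = ⟨k, hk⟩
            · subst e; simp
            · exact absurd (rank_inj huS hmem (hrank.trans (hrk.trans hd').symm)) e
        -- Equality is tested by adding the two truncated differences, whose sum vanishes only if
        -- the numbers agree.
        · have hne0 : d - cardLt S k + (cardLt S k - d) ≠ 0 := by omega
          simp [chooseBody, RamProg.eval, RamInstr.apply, h24, hi, e1, h₁, hmk, h₂, h3', hc, h37, h33, hne0,
            -Nat.add_eq_zero_iff]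
          refine ⟨fun a ha' => ?_, fun u => ?_, fun u huS hu' hrank => ?_⟩
          · simp [ha', ha]
          · by_cases e : u = ⟨k, hk⟩
            · subst e
              simp [hmem, hrk, hd']
            · have := hne u e
              simp [this, show ((u : ℕ) ≤ k ↔ (u : ℕ) < k) by omega, hm u]
          · have e : u ≠ ⟨k, hk⟩ := by
              rintro rfl
              exact hd' (hrk.symm.trans hrank)
            exact hsel u huS (by rw [← hlt u e]; omega) hrank
      · rw [cardLt_succ_of_notMem (u := ⟨k, hk⟩) hmem]
        have hltS : ∀ u ∈ S, ((u : ℕ) < k + 1 ↔ (u : ℕ) < k) := fun u huS =>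
          hlt u fun e => hmem (e ▸ huS)
        have hpost : ∀ s₃ : RamState, s₃.arr = s₂.arr → s₃.reg 33 = s₂.reg 33 →
            s₃.reg 37 = s₂.reg 37 → s₃.reg 38 = s₂.reg 38 → s₃.reg 39 = s₂.reg 39 →
            s₃.reg 40 = s₂.reg 40 → (∀ a ≠ 2, s₃.arr a = s.arr a) ∧ s₃.reg 33 = s.reg 33 ∧
            s₃.reg 37 = d ∧ s₃.reg 38 = cardLt S k ∧
            (∀ u : Fin n, s₃.arr 2 u =
              if u ∈ S ∧ (u : ℕ) < k + 1 then if rank S u = d then 1 else 2 else s.arr 2 u) ∧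
            ∀ u ∈ S, (u : ℕ) < k + 1 → rank S u = d → s₃.reg 39 = u ∧ s₃.reg 40 = u * n := by
          intro s₃ g₁ g₂ g₃ g₄ g₅ g₆
          rw [g₁, g₂, g₃, g₄, g₅, g₆]
          refine ⟨ha, h33, h37, hc, fun u => ?_, fun u huS hu' => hsel u huS ((hltS u huS).1 hu')⟩
          rw [hm u]
          exact if_congr (and_congr_right fun h => (hltS u h).symm) rfl rfl
        rw [hu] at hmem
        by_cases h₁ : s.arr 1 (s.reg 24 + k) = 0
        · refine hpost _ ?_ ?_ ?_ ?_ ?_ ?_ <;>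
            simp [chooseBody, RamProg.eval, RamInstr.apply, h24, hi, e1, h₁]
        · have h₂ : s.arr 2 k ≠ 0 := fun h => hmem ⟨h₁, h⟩
          refine hpost _ ?_ ?_ ?_ ?_ ?_ ?_ <;>
            simp [chooseBody, RamProg.eval, RamInstr.apply, h24, hi, e1, h₁, hmk, h₂]
  · rintro s₂ ⟨hr, h₁, h₂, -, -, h₃, h₄⟩
    refine ⟨hr, h₁, h₂, fun u => ?_, fun u hu => h₄ u hu u.2⟩
    rw [h₃ u]
    simp

/-- The effect of extending the path by the vertex `u`. -/
structure Extended (S : Finset (Fin n)) (u : Fin n) (s s' : RamState) : Prop where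
  reg_eq : ∀ r < 23, s'.reg r = s.reg r
  arr_eq : ∀ a ≠ 2, s'.arr a = s.arr a
  mark : ∀ v : Fin n, s'.arr 2 v = if v ∈ S then if v = u then 1 else 2 else s.arr 2 v
  vertex : s'.reg 23 = u
  offset : s'.reg 24 = u * n
  bound : s'.reg 25 = s.reg 25 + (S.card - 1)
  weight : s'.reg 26 = s.reg 26 + s.arr 0 u
  go : s'.reg 27 = s.reg 27
  found : s'.reg 28 = s.reg 28

theorem runs_extendProg {S : Finset (Fin n)} {u : Fin n} {s : RamState} (h0 : s.reg 0 = n)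
    (h3 : s.reg 3 = 1) (hS : IsCand S s) (h33 : s.reg 33 = S.card) (hu : u ∈ S)
    (hrank : rank S u = min (s.arr 3 (s.reg 25)) (S.card - 1)) :
    Runs extendProg s (22 * n + 18) (Extended S u s) := by
  refine Runs.seq (T₁ := 6) (T₂ := 22 * n + 12) (Q := fun s₁ =>
    (∀ r < 30, s₁.reg r = s.reg r) ∧ s₁.arr = s.arr ∧ s₁.reg 33 = s.reg 33 ∧
      s₁.reg 37 = rank S u ∧ s₁.reg 38 = 0)
    (.block le_rfl ⟨fun r hr => ?_, ?_, ?_, ?_, ?_⟩) (by omega) ?_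
  · simp [RamInstr.apply, show r ≠ 37 by omega, show r ≠ 38 by omega, show r ≠ 39 by omega]
  · simp [RamInstr.apply]
  · simp [RamInstr.apply]
  -- The minimum of `a` and `b` is computed as `a - (a - b)` with truncated subtraction.
  · simp [RamInstr.apply, h33, h3]
    omega
  · simp [RamInstr.apply]
  rintro s₁ ⟨hf, ha, h33', h37, h38⟩
  refine Runs.seq (T₂ := 7) (runs_choose (S := S) ((hf 0 (by norm_num)).trans h0)
    ((hf 3 (by norm_num)).trans h3) ?_ h37 h38) (by omega) ?_
  · intro v
    rw [hS v, ha, hf 24 (by norm_num)]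
  rintro s₂ ⟨hf', ha', h33'', hm, hsel⟩
  have hf2 : ∀ r < 30, s₂.reg r = s.reg r := fun r hr => (hf' r hr).trans (hf r hr)
  obtain ⟨h39, h40⟩ := hsel u hu rfl
  have h33e : s₂.reg 33 = S.card := h33''.trans (h33'.trans h33)
  refine .block le_rfl ⟨fun r hr => ?_, fun a h => ?_, fun v => ?_, ?_, ?_, ?_, ?_, ?_, ?_⟩
  · simp [RamInstr.apply, show r ≠ 23 by omega, show r ≠ 24 by omega, show r ≠ 25 by omega,
      show r ≠ 26 by omega, show r ≠ 34 by omega, show r ≠ 35 by omega, hf2 r (by omega)]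
  · simp [RamInstr.apply, ha' a h, ha]
  · simp only [eval_block_cons, eval_block_nil, RamInstr.apply]
    rw [hm v, ha]
    by_cases hv : v ∈ S
    · simp only [hv, if_true]
      exact if_congr ⟨fun e => rank_inj hv hu e, fun e => e ▸ rfl⟩ rfl rfl
    · simp only [hv, if_false]
  · simp [RamInstr.apply, h39]
  · simp [RamInstr.apply, h40]
  · simp [RamInstr.apply, h33e, hf2, h3]
  · simp [RamInstr.apply, h39, hf2, ha' 0, ha]
  · simp [RamInstr.apply, hf2]
  · simp [RamInstr.apply, hf2]

section Simulation

open Classical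

variable {n : ℕ} {G : SimpleGraph (Fin n)} {ω : Fin n → ℕ} {t w : ℕ}

/-! ### Simulating the growth of a path -/

theorem inputState_arr_zero (u : Fin n) : (inputState G ω t w).arr 0 u = ω u := by
  simp [inputState]

theorem inputState_arr_one (u v : Fin n) :
    (inputState G ω t w).arr 1 (u * n + v) ≠ 0 ↔ G.Adj u v := by
  have key : (∃ u' v' : Fin n, (u : ℕ) * n + v = u' * n + v' ∧ G.Adj u' v') ↔ G.Adj u v := by
    refine ⟨?_, fun h => ⟨u, v, rfl, h⟩⟩
    rintro ⟨u', v', e, h⟩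
    have hn : 0 < n := u.pos
    have e₁ : (u : ℕ) = u' := by
      have := congrArg (· / n) e
      simpa [Nat.add_div_of_dvd_right, Nat.mul_add_div, mul_comm _ n, hn, Nat.div_eq_of_lt]
        using this
    have e₂ : (v : ℕ) = v' := by rw [e₁] at e; omega
    rw [Fin.ext e₁, Fin.ext e₂]
    exact h
  simp only [inputState]
  by_cases h : G.Adj u v <;> simp [key, h]

theorem isSecludedLongPath_iff {f : ℕ → Fin n} {k : ℕ} (hf : IsPathSeq G f k) :
    IsSecludedLongPath G ω t w (pre f k) ↔
      (bnd G f k).card + (cand G f k).card ≤ t ∧ w ≤ ∑ u ∈ pre f k, ω u := by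
  rw [IsSecludedLongPath, isSecluded_pre]
  refine ⟨fun h => ⟨h.2.1, h.2.2.trans_eq ?_⟩,
    fun h => ⟨hf.isInducedPath, h.1, h.2.trans_eq ?_⟩⟩ <;>
  · refine Finset.sum_congr ?_ fun _ _ => rfl
    ext; simp

/-- The parts of the memory that the program never changes. -/
structure Fixed (G : SimpleGraph (Fin n)) (ω : Fin n → ℕ) (t w : ℕ) (s : RamState) : Prop where
  size : s.reg 0 = n
  param : s.reg 1 = t
  target : s.reg 2 = w
  one : s.reg 3 = 1
  arr_zero : s.arr 0 = (inputState G ω t w).arr 0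
  arr_one : s.arr 1 = (inputState G ω t w).arr 1

theorem Fixed.congr {s s' : RamState} (h : Fixed G ω t w s) (hr : ∀ r < 4, s'.reg r = s.reg r)
    (h0 : s'.arr 0 = s.arr 0) (h1 : s'.arr 1 = s.arr 1) : Fixed G ω t w s' :=
  ⟨(hr 0 (by norm_num)).trans h.size, (hr 1 (by norm_num)).trans h.param,
    (hr 2 (by norm_num)).trans h.target, (hr 3 (by norm_num)).trans h.one,
    h0.trans h.arr_zero, h1.trans h.arr_one⟩

/-- The memory represents the path `f 0, …, f i`. -/
structure Represents (G : SimpleGraph (Fin n)) (ω : Fin n → ℕ) (f : ℕ → Fin n) (i : ℕ)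
    (s : RamState) : Prop where
  mark : ∀ u : Fin n, s.arr 2 u = if u ∈ pre f i then 1 else if u ∈ bnd G f i then 2 else 0
  vertex : s.reg 23 = f i
  offset : s.reg 24 = f i * n
  bound : s.reg 25 = (bnd G f i).card
  weight : s.reg 26 = ∑ u ∈ pre f i, ω u

theorem Represents.congr {f f' : ℕ → Fin n} {i : ℕ} {s s' : RamState}
    (h : Represents G ω f i s) (hf : ∀ j ≤ i, f' j = f j) (ha : s'.arr 2 = s.arr 2)
    (hr : ∀ r, 23 ≤ r → r < 27 → s'.reg r = s.reg r) : Represents G ω f' i s' := by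
  refine ⟨?_, ?_, ?_, ?_, ?_⟩
  · rw [ha, pre_congr hf, bnd_congr hf]; exact h.mark
  · rw [hr 23 (by norm_num) (by norm_num), hf i le_rfl]; exact h.vertex
  · rw [hr 24 (by norm_num) (by norm_num), hf i le_rfl]; exact h.offset
  · rw [hr 25 (by norm_num) (by norm_num), bnd_congr hf]; exact h.bound
  · rw [hr 26 (by norm_num) (by norm_num), pre_congr hf]; exact h.weight

theorem Represents.isCand {f : ℕ → Fin n} {i : ℕ} {s : RamState}
    (h : Represents G ω f i s) (hs : Fixed G ω t w s) : IsCand (cand G f i) s := by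
  intro u
  rw [h.offset, hs.arr_one, inputState_arr_one, h.mark u, mem_cand]
  by_cases h₁ : u ∈ pre f i
  · simp [h₁]
  · by_cases h₂ : u ∈ bnd G f i <;> simp [h₁, h₂]

/-- Two sequences represented by the same memory state thus have the same candidates, even though
the state does not record the order of the path. -/
theorem IsCand.unique {S S' : Finset (Fin n)} {s : RamState} (h : IsCand S s)
    (h' : IsCand S' s) : S = S' := by
  ext u; rw [h u, h' u]

theorem Represents.outputSet_eq {f : ℕ → Fin n} {i : ℕ} {s : RamState}
    (h : Represents G ω f i s) : outputSet n s = pre f i := by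
  ext u
  simp only [outputSet, Set.mem_ofPred_eq, h.mark u, Finset.mem_coe]
  by_cases h₁ : u ∈ pre f i
  · simp [h₁]
  · by_cases h₂ : u ∈ bnd G f i <;> simp [h₁, h₂]

theorem Represents.succ {f : ℕ → Fin n} {i : ℕ} {s s' : RamState}
    (h : Represents G ω f i s) (hs : Fixed G ω t w s) (hf : f (i + 1) ∈ cand G f i)
    (he : Extended (cand G f i) (f (i + 1)) s s') : Represents G ω f (i + 1) s' := by
  obtain ⟨h₁, h₂, h₃⟩ := mem_cand.1 hf
  refine ⟨fun u => ?_, he.vertex, he.offset, ?_, ?_⟩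
  · rw [he.mark u, h.mark u, pre_succ, bnd_succ hf]
    by_cases hu : u = f (i + 1)
    · simp [hu, hf]
    · by_cases hc : u ∈ cand G f i
      · have := mem_cand.1 hc
        simp [hu, hc, this.1]
      · simp [hu, hc]
  · rw [he.bound, h.bound, card_bnd_succ hf]
  · rw [he.weight, h.weight, pre_succ, Finset.sum_insert h₁, hs.arr_zero, inputState_arr_zero,
      add_comm]

/-- Invariant for the growth of a path: after `j` rounds, starting from the vertex `v` and
following the digits `b`. -/
structure PathInv (G : SimpleGraph (Fin n)) (ω : Fin n → ℕ) (t w : ℕ) (b : ℕ → ℕ) (v : ℕ)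
    (j : ℕ) (s : RamState) : Prop where
  arr_zero : s.arr 0 = (inputState G ω t w).arr 0
  arr_one : s.arr 1 = (inputState G ω t w).arr 1
  arr_three : s.arr 3 = b
  cases : s.reg 28 = 1 ∧ s.reg 27 = 0 ∧ IsSecludedLongPath G ω t w (outputSet n s) ∨
    s.reg 28 = 0 ∧
      (s.reg 27 ≠ 0 → ∃ f : ℕ → Fin n, IsPathSeq G f j ∧ Represents G ω f j s) ∧
      ∀ (f : ℕ → Fin n) (k : ℕ), (f 0 : ℕ) = v → IsPathSeq G f k →
        IsSecludedLongPath G ω t w (pre f k) → Follows G f b k →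
        s.reg 27 ≠ 0 ∧ j ≤ k ∧ Represents G ω f j s

theorem outputSet_congr {s s' : RamState} (h : s'.arr 2 = s.arr 2) :
    outputSet n s' = outputSet n s := by
  simp only [outputSet, h]

theorem PathInv.congr {b : ℕ → ℕ} {v j : ℕ} {s s' : RamState}
    (h : PathInv G ω t w b v j s) (ha : s'.arr = s.arr)
    (hr : ∀ r, 23 ≤ r → s'.reg r = s.reg r) : PathInv G ω t w b v j s' := by
  have hrep : ∀ f, Represents G ω f j s → Represents G ω f j s' := fun f hf =>
    hf.congr (fun _ _ => rfl) (by rw [ha]) fun r h _ => hr r h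
  refine ⟨by rw [ha]; exact h.arr_zero, by rw [ha]; exact h.arr_one,
    by rw [ha]; exact h.arr_three, ?_⟩
  rw [hr 27 (by norm_num), hr 28 (by norm_num), outputSet_congr (s := s) (s' := s') (by rw [ha])]
  rcases h.cases with h' | ⟨h₁, h₂, h₃⟩
  · exact .inl h'
  · refine .inr ⟨h₁, fun hg => ?_, fun f k g₁ g₂ g₃ g₄ => ?_⟩
    · obtain ⟨f, g₁, g₂⟩ := h₂ hg
      exact ⟨f, g₁, hrep f g₂⟩
    · obtain ⟨g₅, g₆, g₇⟩ := h₃ f k g₁ g₂ g₃ g₄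
      exact ⟨g₅, g₆, hrep f g₇⟩

/-- The invariant compares the stored path with every solution that starts in `v` and follows `b`.
All of them are represented by the same state, so they share its candidates and boundary size, and
the digit selects the next vertex of each. If the test fails, none of them can end at index `j`. -/
theorem runs_stepBody {b : ℕ → ℕ} {v j : ℕ} {s : RamState} (hs : Fixed G ω t w s)
    (h : PathInv G ω t w b v j s) :
    Runs stepBody s (35 * n + 40) (fun s' => (∀ r < 23, s'.reg r = s.reg r) ∧
      PathInv G ω t w b v (j + 1) s') := by
  refine (Runs.cond (T := 35 * n + 39) (fun hgo => ?_) (fun hgo => ?_))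
  swap
  · refine .block (by simp) (by
      rw [eval_block_nil]
      refine ⟨fun _ _ => rfl, h.arr_zero, h.arr_one, h.arr_three, ?_⟩
      rcases h.cases with h' | ⟨h₁, h₂, h₃⟩
      · exact .inl h'
      · exact .inr ⟨h₁, fun g => absurd hgo g, fun f k g₁ g₂ g₃ g₄ =>
          absurd hgo (h₃ f k g₁ g₂ g₃ g₄).1⟩)
  obtain ⟨h28, hex, hall⟩ : s.reg 28 = 0 ∧ _ := by
    rcases h.cases with ⟨_, h', _⟩ | h'
    · exact absurd h' hgo
    · exact h'
  obtain ⟨f, hf, hrep⟩ := hex hgo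
  have hS := hrep.isCand hs
  have hSeq : ∀ f', Represents G ω f' j s → cand G f' j = cand G f j := fun f' hf' =>
    (hf'.isCand hs).unique hS
  refine (runs_countProg hs.size hs.one hS).seq (T₂ := 22 * n + 30) (by omega) ?_
  rintro s₁ ⟨hr₁, ha₁, h33⟩
  refine Runs.seq (T₁ := 5) (T₂ := 22 * n + 22) (Q := fun s₂ => (∀ r < 34, s₂.reg r = s₁.reg r) ∧
    s₂.arr = s₁.arr ∧ (s₂.reg 35 = 0 ↔
      (bnd G f j).card + (cand G f j).card ≤ t ∧ w ≤ ∑ u ∈ pre f j, ω u))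
    (.block le_rfl ⟨fun r hr => eval_reg_of_lt (by decide) hr _, ?_, ?_⟩) (by omega) ?_
  · simp [RamInstr.apply]
  · simp [RamInstr.apply, hr₁, h33, hs.param, hs.target, hrep.bound, hrep.weight,
      Nat.sub_eq_zero_iff_le]
  rintro s₂ ⟨hr₂, ha₂, htest⟩
  have hr : ∀ r < 30, s₂.reg r = s.reg r := fun r hr =>
    (hr₂ r (by omega)).trans (hr₁ r hr)
  have ha : s₂.arr = s.arr := ha₂.trans ha₁
  have h33' : s₂.reg 33 = (cand G f j).card := (hr₂ 33 (by norm_num)).trans h33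
  refine (Runs.cond (T := 22 * n + 20) (fun h35 => ?_) (fun h35 => ?_)).mono (by omega)
    (fun _ h => h)
  · rw [ne_eq, htest, ← isSecludedLongPath_iff hf] at h35
    have hlt : ∀ (f' : ℕ → Fin n) (k : ℕ), (f' 0 : ℕ) = v → IsPathSeq G f' k →
        IsSecludedLongPath G ω t w (pre f' k) → Follows G f' b k →
        j < k ∧ Represents G ω f' j s := by
      intro f' k g₁ g₂ g₃ g₄
      obtain ⟨-, g₅, g₆⟩ := hall f' k g₁ g₂ g₃ g₄
      refine ⟨lt_of_le_of_ne g₅ ?_, g₆⟩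
      rintro rfl
      -- If `k = j`, the solution has the same vertex set as the stored path, which failed the test.
      rw [← g₆.outputSet_eq, hrep.outputSet_eq] at g₃
      exact h35 g₃
    refine (Runs.cond (T := 22 * n + 18) (fun hc => ?_) (fun hc => ?_)).mono (by omega)
      (fun _ h => h)
    · rw [h33'] at hc
      obtain ⟨u, hu, hrank⟩ := exists_rank_eq (S := cand G f j)
        (d := min (b (bnd G f j).card) ((cand G f j).card - 1)) (by omega)
      have hS₂ : IsCand (cand G f j) s₂ := by
        intro x
        rw [ha, hr 24 (by norm_num)]
        exact hS x
      refine (runs_extendProg ((hr 0 (by norm_num)).trans hs.size)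
        ((hr 3 (by norm_num)).trans hs.one) hS₂ h33' hu ?_).mono le_rfl ?_
      · rw [ha, h.arr_three, hr 25 (by norm_num), hrep.bound]; exact hrank
      intro s₃ he
      have hr₃ : ∀ r < 23, s₃.reg r = s.reg r := fun r h =>
        (he.reg_eq r h).trans (hr r (by omega))
      have hfix : Fixed G ω t w s₂ := hs.congr (fun r h => hr r (by omega)) (by rw [ha])
        (by rw [ha])
      refine ⟨hr₃, ?_, ?_, ?_, .inr ⟨?_, fun _ => ?_, fun f' k g₁ g₂ g₃ g₄ => ?_⟩⟩
      · rw [he.arr_eq 0 (by norm_num), ha]; exact h.arr_zero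
      · rw [he.arr_eq 1 (by norm_num), ha]; exact h.arr_one
      · rw [he.arr_eq 3 (by norm_num), ha]; exact h.arr_three
      · rw [he.found, hr 28 (by norm_num)]; exact h28
      · have hcongr : ∀ i ≤ j, Function.update f (j + 1) u i = f i := fun i hi =>
          Function.update_of_ne (by omega) _ _
        have hu' : Function.update f (j + 1) u (j + 1) = u := Function.update_self ..
        have hmem : Function.update f (j + 1) u (j + 1) ∈
            cand G (Function.update f (j + 1) u) j := by
          rw [hu', cand_congr hcongr]; exact hu
        refine ⟨Function.update f (j + 1) u, (hf.congr hcongr).succ hmem, ?_⟩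
        refine (hrep.congr (s' := s₂) hcongr (by rw [ha]) fun r _ h => hr r (by omega)).succ
          hfix hmem ?_
        rw [hu', cand_congr hcongr]; exact he
      · obtain ⟨hjk, hrep'⟩ := hlt f' k g₁ g₂ g₃ g₄
        have hmem := g₂.mem_cand hjk
        have hu' : f' (j + 1) = u := by
          have h₁ := g₄ j hjk
          have h₂ : (bnd G f' j).card = (bnd G f j).card := hrep'.bound.symm.trans hrep.bound
          rw [selectedRank, hSeq f' hrep', h₂, ← hrank] at h₁
          exact rank_inj (hSeq f' hrep' ▸ hmem) hu h₁
        refine ⟨?_, hjk, (hrep'.congr (s' := s₂) (fun _ _ => rfl) (by rw [ha])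
          fun r _ h => hr r (by omega)).succ hfix hmem ?_⟩
        · rw [he.go, hr 27 (by norm_num)]; exact hgo
        · rw [hu', hSeq f' hrep']; exact he
    · rw [h33'] at hc
      refine .block (by simp) ⟨fun r h => ?_, ?_⟩
      · rw [eval_reg_of_lt (L := 23) (by decide) h, hr r (by omega)]
      · refine ⟨?_, ?_, ?_, .inr ⟨?_, fun g => ?_, fun f' k g₁ g₂ g₃ g₄ => ?_⟩⟩
        · simp [RamInstr.apply, ha, h.arr_zero]
        · simp [RamInstr.apply, ha, h.arr_one]
        · simp [RamInstr.apply, ha, h.arr_three]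
        · simp [RamInstr.apply, hr, h28]
        · simp [RamInstr.apply] at g
        · obtain ⟨hjk, hrep'⟩ := hlt f' k g₁ g₂ g₃ g₄
          have := Finset.card_pos.2 ⟨_, g₂.mem_cand hjk⟩
          rw [hSeq f' hrep'] at this
          omega
  · rw [htest, ← isSecludedLongPath_iff hf] at h35
    refine .block (by simp) ⟨fun r h => ?_, ?_⟩
    · rw [eval_reg_of_lt (L := 23) (by decide) h, hr r (by omega)]
    · refine ⟨?_, ?_, ?_, .inl ⟨?_, ?_, ?_⟩⟩
      · simp [RamInstr.apply, ha, h.arr_zero]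
      · simp [RamInstr.apply, ha, h.arr_one]
      · simp [RamInstr.apply, ha, h.arr_three]
      · simp [RamInstr.apply]
      · simp [RamInstr.apply]
      · rw [outputSet_congr (s := s) (by simp [RamInstr.apply, ha]), hrep.outputSet_eq]
        exact h35

/-! ### The search from a fixed start vertex. -/

/-- No solution that starts in `v` follows the digits `b`. -/
def NoSolution (G : SimpleGraph (Fin n)) (ω : Fin n → ℕ) (t w : ℕ) (b : ℕ → ℕ) (v : ℕ) : Prop :=
  ∀ (f : ℕ → Fin n) (k : ℕ), (f 0 : ℕ) = v → IsPathSeq G f k →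
    IsSecludedLongPath G ω t w (pre f k) → ¬ Follows G f b k

/-- Arrays `0`, `1` and `3` are as they should be, and register `28` tells whether a solution has
been found; if not, then `R` holds. -/
structure SearchInv (G : SimpleGraph (Fin n)) (ω : Fin n → ℕ) (t w : ℕ) (b : ℕ → ℕ) (R : Prop)
    (s : RamState) : Prop where
  arr_zero : s.arr 0 = (inputState G ω t w).arr 0
  arr_one : s.arr 1 = (inputState G ω t w).arr 1
  arr_three : s.arr 3 = b
  cases : s.reg 28 = 1 ∧ IsSecludedLongPath G ω t w (outputSet n s) ∨ s.reg 28 = 0 ∧ R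

theorem runs_runProg {b : ℕ → ℕ} {v : Fin n} {s : RamState} (hs : Fixed G ω t w s)
    (hb : s.arr 3 = b) (h28 : s.reg 28 = 0) (hv : s.reg 10 = v) (ho : s.reg 11 = v * n) :
    Runs runProg s (100 * (n + 1) ^ 2) (fun s' => (∀ r < 20, s'.reg r = s.reg r) ∧
      SearchInv G ω t w b (NoSolution G ω t w b v) s') := by
  have hclear : Runs (forLoop 0 30 (block [const 33 0, store 2 30 33])) s (n * (3 + 5) + 5)
      (fun s' => (∀ r < 30, s'.reg r = s.reg r) ∧ (∀ a ≠ 2, s'.arr a = s.arr a) ∧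
        ∀ u : ℕ, u < n → s'.arr 2 u = 0) := by
    refine runs_forLoop (I := fun k s' => (∀ a ≠ 2, s'.arr a = s.arr a) ∧
      ∀ u < k, s'.arr 2 u = 0) (by norm_num) (by norm_num) hs.size hs.one ?_
      ⟨fun _ _ => rfl, by simp⟩ ?_
    · rintro k s₁ s₂ e - h
      rw [e]; exact h
    · rintro k hk s₁ - hi - ⟨h₁, h₂⟩
      refine .block (by simp) ⟨fun r hr => eval_reg_of_lt (by decide) hr _, fun a ha => ?_,
        fun u hu => ?_⟩
      · simp [RamInstr.apply, ha, h₁]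
      · by_cases e : u = k
        · simp [RamInstr.apply, hi, e]
        · simp [RamInstr.apply, hi, e, h₂ u (by omega)]
  refine hclear.seq (T₂ := 7 + (n * (35 * n + 40 + 5) + 5)) (by nlinarith) ?_
  rintro s₁ ⟨hr₁, ha₁, hz⟩
  refine Runs.seq (T₁ := 7) (Q := fun s₂ => (∀ r < 20, s₂.reg r = s.reg r) ∧
    PathInv G ω t w b v 0 s₂) (.block le_rfl ⟨fun r h => ?_, ?_⟩) le_rfl ?_
  · rw [eval_reg_of_lt (L := 20) (by decide) h, hr₁ r (by omega)]
  · have hrep : ∀ f : ℕ → Fin n, f 0 = v → Represents G ω f 0 ((block [store 2 10 3, move 23 10,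
        move 24 11, const 25 0, load 26 0 10, const 27 1]).eval s₁) := by
      rintro f rfl
      have hpre : pre f 0 = {f 0} := by simp [pre]
      have hbnd : bnd G f 0 = ∅ := by
        ext u; simp [mem_bnd]
      refine ⟨fun u => ?_, ?_, ?_, ?_, ?_⟩
      · by_cases e : u = f 0
        · simp [RamInstr.apply, hpre, e, hr₁, hv, hs.one]
        · have e' : (u : ℕ) ≠ f 0 := fun h => e (Fin.ext h)
          simp [RamInstr.apply, hpre, hbnd, e, e', hr₁, hv, hz u u.2]
      · simp [RamInstr.apply, hr₁, hv]
      · simp [RamInstr.apply, hr₁, ho]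
      · simp [RamInstr.apply, hbnd]
      · simp [RamInstr.apply, hpre, hr₁, hv, ha₁ 0, hs.arr_zero, inputState_arr_zero]
    refine ⟨?_, ?_, ?_, .inr ⟨?_, fun _ => ?_, fun f k g₁ g₂ g₃ g₄ => ?_⟩⟩
    · simp [RamInstr.apply, ha₁ 0, hs.arr_zero]
    · simp [RamInstr.apply, ha₁ 1, hs.arr_one]
    · simp [RamInstr.apply, ha₁ 3, hb]
    · simp [RamInstr.apply, hr₁, h28]
    · exact ⟨fun _ => v, isPathSeq_zero, hrep _ rfl⟩
    · refine ⟨by simp [RamInstr.apply], Nat.zero_le _, hrep f (Fin.ext g₁)⟩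
  rintro s₂ ⟨hr₂, hinv⟩
  refine (runs_forLoop (N := n) (I := fun j s' => PathInv G ω t w b v j s') (by norm_num)
    (by norm_num) ((hr₂ 0 (by norm_num)).trans hs.size) ((hr₂ 3 (by norm_num)).trans hs.one)
    (fun k s₃ s₄ e hr h => h.congr e hr) hinv ?_).mono le_rfl ?_
  · rintro k hk s₃ hr₃ - - h
    refine runs_stepBody ⟨?_, ?_, ?_, ?_, h.arr_zero, h.arr_one⟩ h
    · rw [hr₃ 0 (by norm_num), hr₂ 0 (by norm_num), hs.size]
    · rw [hr₃ 1 (by norm_num), hr₂ 1 (by norm_num), hs.param]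
    · rw [hr₃ 2 (by norm_num), hr₂ 2 (by norm_num), hs.target]
    · rw [hr₃ 3 (by norm_num), hr₂ 3 (by norm_num), hs.one]
  · rintro s₃ ⟨hr₃, h⟩
    refine ⟨fun r hr => (hr₃ r hr).trans (hr₂ r hr), h.arr_zero, h.arr_one, h.arr_three, ?_⟩
    rcases h.cases with ⟨h₁, -, h₂⟩ | ⟨h₁, -, h₂⟩
    · exact .inl ⟨h₁, h₂⟩
    · refine .inr ⟨h₁, fun f k g₁ g₂ g₃ g₄ => ?_⟩
      -- After `n` rounds an undetected solution would have last index `k ≥ n`, but the vertices of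
      -- a path are distinct.
      have := (h₂ f k g₁ g₂ g₃ g₄).2.1
      have := g₂.lt
      omega

end Simulation

section Search

variable {n : ℕ} {G : SimpleGraph (Fin n)} {ω : Fin n → ℕ} {t w : ℕ}

/-! ### The digit counter -/

theorem digit_of_lt {B x i t : ℕ} (hB : 0 < B) (hx : x < B ^ t) (h : t ≤ i) :
    digit B x i = 0 := by
  rw [digit, Nat.div_eq_of_lt (hx.trans_le (Nat.pow_le_pow_right hB h)), Nat.zero_mod]

/-- After `k` rounds the carry is the difference between the quotients of `x + 1` and `x` by `(t +
1) ^ k`. For `k = t` the quotient of `x` vanishes, so the final carry is 1 exactly on overflow. -/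
theorem runs_incProg {x : ℕ} {s : RamState} (hs : Fixed G ω t w s)
    (h3 : s.arr 3 = digit (t + 1) x) (hx : x < (t + 1) ^ t) :
    Runs incProg s (14 * t + 12) (fun s' => (∀ r < 5, s'.reg r = s.reg r) ∧
      s'.reg 28 = s.reg 28 ∧ (∀ a ≠ 3, s'.arr a = s.arr a) ∧
      ((x + 1 < (t + 1) ^ t ∧ s'.reg 5 = 1 ∧ s'.arr 3 = digit (t + 1) (x + 1)) ∨
        (x + 1 = (t + 1) ^ t ∧ s'.reg 5 = 0))) := by
  have hB : 0 < t + 1 := Nat.succ_pos t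
  refine Runs.seq (T₁ := 2) (T₂ := 14 * t + 10) (Q := fun s₁ => (∀ r < 33, s₁.reg r = s.reg r) ∧
    s₁.arr = s.arr ∧ s₁.reg 33 = 1)
    (.block le_rfl ⟨fun r hr => eval_reg_of_lt (by decide) hr _, ?_, ?_⟩) (by omega) ?_
  · simp [RamInstr.apply]
  · simp [RamInstr.apply]
  rintro s₁ ⟨hr₁, ha₁, h33⟩
  refine Runs.seq (T₁ := t * (9 + 5) + 5) (T₂ := 2) (runs_forLoop (N := t)
    (I := fun k s₂ => s₂.reg 28 = s.reg 28 ∧ (∀ a ≠ 3, s₂.arr a = s.arr a) ∧ s₂.reg 33 ≤ 1 ∧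
      (x + 1) / (t + 1) ^ k = x / (t + 1) ^ k + s₂.reg 33 ∧
      ∀ i, s₂.arr 3 i = if i < k then digit (t + 1) (x + 1) i else digit (t + 1) x i)
    (by norm_num) (by norm_num) ((hr₁ 1 (by norm_num)).trans hs.param)
    ((hr₁ 3 (by norm_num)).trans hs.one) ?_ ?_ ?_) (by omega) ?_
  · rintro k s₂ s₃ e hr ⟨h₀, h₁, h₂, h₃, h₄⟩
    rw [e, hr 33 (by norm_num), hr 28 (by norm_num)]
    exact ⟨h₀, h₁, h₂, h₃, h₄⟩
  · exact ⟨hr₁ 28 (by norm_num), fun a _ => by rw [ha₁], h33.le, by simp [h33],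
      by simp [ha₁, h3]⟩
  · rintro k hk s₂ hr₂ hi - ⟨h₀, h₁, h₂, h₃, h₄⟩
    have e1 : s₂.reg 1 = t := ((hr₂ 1 (by norm_num)).trans (hr₁ 1 (by norm_num))).trans hs.param
    have e3 : s₂.reg 3 = 1 := ((hr₂ 3 (by norm_num)).trans (hr₁ 3 (by norm_num))).trans hs.one
    have hdk : s₂.arr 3 k = digit (t + 1) x k := by simp [h₄ k]
    have hdlt : digit (t + 1) x k < t + 1 := Nat.mod_lt _ hB
    have hpow : ∀ y, y / (t + 1) ^ (k + 1) = y / (t + 1) ^ k / (t + 1) := fun y => by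
      rw [pow_succ, Nat.div_div_eq_div_mul]
    have hext : ∀ (a : ℕ → ℕ), a k = digit (t + 1) (x + 1) k →
        (∀ i ≠ k, a i = s₂.arr 3 i) → ∀ i, a i =
          if i < k + 1 then digit (t + 1) (x + 1) i else digit (t + 1) x i := by
      intro a hak hne i
      by_cases e : i = k
      · simp [e, hak]
      · rw [hne i e, h₄ i]
        exact if_congr (by omega) rfl rfl
    refine .of_eval rfl (by decide) ⟨fun r hr => eval_reg_of_lt (by decide) hr _, ?_⟩
    rw [hpow, hpow, h₃]
    by_cases hc : s₂.reg 33 = 0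
    · have : digit (t + 1) x k = digit (t + 1) (x + 1) k := by
        rw [digit, digit, h₃, hc, add_zero]
      simp only [incBody, RamProg.eval, hc, if_true, eval_block_nil, add_zero, zero_le_one,
        true_and]
      exact ⟨h₀, h₁, hext _ (hdk.trans this) fun _ _ => rfl⟩
    · have hc1 : s₂.reg 33 = 1 := by omega
      have hd' : digit (t + 1) (x + 1) k = (x / (t + 1) ^ k + 1) % (t + 1) := by
        rw [digit, h₃, hc1]
      have hdx : digit (t + 1) x k = x / (t + 1) ^ k % (t + 1) := rfl
      have hdm := Nat.div_add_mod (x / (t + 1) ^ k) (t + 1)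
      rw [← hdx] at hdm
      by_cases hlt : digit (t + 1) x k < t
      · have hne : t - digit (t + 1) x k ≠ 0 := by omega
        have hq : (x / (t + 1) ^ k + 1) / (t + 1) = x / (t + 1) ^ k / (t + 1) ∧
            (x / (t + 1) ^ k + 1) % (t + 1) = digit (t + 1) x k + 1 := by
          rw [Nat.div_mod_unique hB]
          exact ⟨by omega, by omega⟩
        rw [hq.2] at hd'
        simp [incBody, RamProg.eval, RamInstr.apply, hc1, hi, hdk, e1, hne, e3, h₀, hq.1]
        refine ⟨fun a ha => by simp [ha, h₁], ?_⟩
        simpa using hext (Function.update (s₂.arr 3) k (digit (t + 1) x k + 1)) (by simp [hd'])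
          fun i hi' => by simp [hi']
      · have heq : digit (t + 1) x k = t := by omega
        have hq : (x / (t + 1) ^ k + 1) / (t + 1) = x / (t + 1) ^ k / (t + 1) + 1 ∧
            (x / (t + 1) ^ k + 1) % (t + 1) = 0 := by
          rw [Nat.div_mod_unique hB]
          exact ⟨by rw [mul_add, mul_one]; omega, hB⟩
        rw [hq.2] at hd'
        simp [incBody, RamProg.eval, RamInstr.apply, hc1, hi, hdk, e1, heq, h₀, hq.1]
        refine ⟨fun a ha => by simp [ha, h₁], ?_⟩
        simpa using hext (Function.update (s₂.arr 3) k 0) (by simp [hd'])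
          fun i hi' => by simp [hi']
  · rintro s₂ ⟨hr₂, h₀, h₁, h₂, h₃, h₄⟩
    have e3 : s₂.reg 3 = 1 := ((hr₂ 3 (by norm_num)).trans (hr₁ 3 (by norm_num))).trans hs.one
    refine .block le_rfl ⟨fun r hr => ?_, ?_, fun a ha => ?_, ?_⟩
    · rw [eval_reg_of_lt (L := 5) (by decide) hr, hr₂ r (by omega), hr₁ r (by omega)]
    · simp [RamInstr.apply, h₀]
    · simp [RamInstr.apply, h₁ a ha]
    · rw [Nat.div_eq_of_lt hx, zero_add] at h₃
      rcases Nat.lt_or_ge (x + 1) ((t + 1) ^ t) with hlt | hge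
      · rw [Nat.div_eq_of_lt hlt] at h₃
        refine .inl ⟨hlt, by simp [RamInstr.apply, e3, ← h₃], ?_⟩
        funext i
        simp only [eval_block_cons, eval_block_nil, RamInstr.apply, h₄ i]
        split_ifs with hi
        · rfl
        -- The loop never touches positions from `t` on, and there both numbers have digit 0.
        · rw [digit_of_lt hB hx (by omega), digit_of_lt hB hlt (by omega)]
      · have hge1 : s₂.reg 33 = 1 := by
          have := Nat.div_pos hge (pow_pos hB t)
          omega
        exact .inr ⟨by omega, by simp [RamInstr.apply, e3, hge1]⟩

/-! ### The main loop -/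

/-- Invariant of the main loop before round `x`. -/
structure MainInv (G : SimpleGraph (Fin n)) (ω : Fin n → ℕ) (t w : ℕ) (x : ℕ)
    (s : RamState) : Prop where
  fixed : Fixed G ω t w s
  arr_three : s.arr 3 = digit (t + 1) x
  continue_eq : s.reg 5 = 1
  found : s.reg 28 = 0
  none : ∀ y < x, ∀ v < n, NoSolution G ω t w (digit (t + 1) y) v

theorem runs_roundProg {x : ℕ} {s : RamState} (h : MainInv G ω t w x s)
    (hx : x < (t + 1) ^ t) :
    Runs roundProg s (150 * (n + 1) ^ 3 * (t + 1)) (fun s' =>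
      (x + 1 < (t + 1) ^ t ∧ MainInv G ω t w (x + 1) s') ∨
        (s'.reg 5 = 0 ∧ (s'.reg 28 = 1 ∧ IsSecludedLongPath G ω t w (outputSet n s') ∨
          s'.reg 28 = 0 ∧ ∀ y < (t + 1) ^ t, ∀ v < n,
            NoSolution G ω t w (digit (t + 1) y) v))) := by
  have hstart : Runs (forLoop 0 10 (.cond 28 (block []) runProg)) s
      (n * (100 * (n + 1) ^ 2 + 1 + 5) + 5) (fun s' => (∀ r < 10, s'.reg r = s.reg r) ∧
        SearchInv G ω t w (digit (t + 1) x)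
          (∀ v < n, NoSolution G ω t w (digit (t + 1) x) v) s') := by
    refine runs_forLoop (N := n) (I := fun k s' => SearchInv G ω t w (digit (t + 1) x)
        (∀ v < k, NoSolution G ω t w (digit (t + 1) x) v) s') (by norm_num) (by norm_num)
      h.fixed.size h.fixed.one ?_ ⟨h.fixed.arr_zero, h.fixed.arr_one, h.arr_three,
        .inr ⟨h.found, by simp⟩⟩ ?_
    · intro k s₁ s₂ e hr g
      refine ⟨by rw [e]; exact g.arr_zero, by rw [e]; exact g.arr_one,
        by rw [e]; exact g.arr_three, ?_⟩
      rw [hr 28 (by norm_num), outputSet_congr (s := s₁) (s' := s₂) (by rw [e])]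
      exact g.cases
    -- Once a solution is found, the remaining start vertices are skipped, so the output in array
    -- `2` is not overwritten.
    · intro k hk s₁ hr hi ho g
      refine Runs.cond (fun hc => .block (by simp; nlinarith) ?_) (fun hc => ?_)
      · rw [eval_block_nil]
        exact ⟨fun _ _ => rfl, g.arr_zero, g.arr_one, g.arr_three,
          .inl (g.cases.resolve_right fun h => hc h.1)⟩
      · have hnone := (g.cases.resolve_left fun h => by simp [hc] at h).2
        have hfix : Fixed G ω t w s₁ := ⟨(hr 0 (by norm_num)).trans h.fixed.size,
          (hr 1 (by norm_num)).trans h.fixed.param, (hr 2 (by norm_num)).trans h.fixed.target,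
          (hr 3 (by norm_num)).trans h.fixed.one, g.arr_zero, g.arr_one⟩
        refine (runs_runProg (v := ⟨k, hk⟩) hfix g.arr_three hc hi
          (by rw [ho, h.fixed.size])).mono le_rfl ?_
        rintro s₂ ⟨hr₂, g₂⟩
        refine ⟨fun r hr => hr₂ r (by omega), g₂.arr_zero, g₂.arr_one, g₂.arr_three,
          g₂.cases.imp_right fun h => ⟨h.1, fun v hv => ?_⟩⟩
        rcases Nat.lt_succ_iff_lt_or_eq.1 hv with hv | rfl
        · exact hnone v hv
        · exact h.2
  refine hstart.seq (T₂ := 14 * t + 12 + 1) ?_ ?_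
  · have : n * (100 * (n + 1) ^ 2 + 1 + 5) + 5 ≤ 106 * (n + 1) ^ 3 := by nlinarith
    have h1 : 1 ≤ (n + 1) ^ 3 := Nat.one_le_pow _ _ (by omega)
    calc _ ≤ 106 * (n + 1) ^ 3 * (t + 1) + 14 * (t + 1) := by nlinarith
      _ ≤ 106 * (n + 1) ^ 3 * (t + 1) + 44 * (n + 1) ^ 3 * (t + 1) := by
        gcongr; omega
      _ = _ := by ring
  rintro s₁ ⟨hr₁, g⟩
  have hfix : Fixed G ω t w s₁ := ⟨(hr₁ 0 (by norm_num)).trans h.fixed.size,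
    (hr₁ 1 (by norm_num)).trans h.fixed.param, (hr₁ 2 (by norm_num)).trans h.fixed.target,
    (hr₁ 3 (by norm_num)).trans h.fixed.one, g.arr_zero, g.arr_one⟩
  refine Runs.cond (fun hc => ?_) (fun hc => ?_)
  · have hsol := g.cases.resolve_right fun h => hc h.1
    refine .block (by simp) (.inr ⟨by simp [RamInstr.apply], .inl ⟨?_, ?_⟩⟩)
    · simp [RamInstr.apply, hsol.1]
    · exact hsol.2
  · have hnone := (g.cases.resolve_left fun h => by simp [hc] at h).2
    have hall : ∀ y < x + 1, ∀ v < n, NoSolution G ω t w (digit (t + 1) y) v := by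
      intro y hy
      rcases Nat.lt_succ_iff_lt_or_eq.1 hy with hy | rfl
      · exact h.none y hy
      · exact hnone
    refine (runs_incProg hfix g.arr_three hx).mono le_rfl ?_
    rintro s₂ ⟨hr₂, h28, ha, ⟨hlt, h5, h3⟩ | ⟨hx', h5⟩⟩
    · exact .inl ⟨hlt, hfix.congr (fun r hr => hr₂ r (by omega)) (ha 0 (by norm_num))
        (ha 1 (by norm_num)), h3, h5, h28.trans hc, hall⟩
    · exact .inr ⟨h5, .inr ⟨h28.trans hc, hx' ▸ hall⟩⟩

theorem runs_mainProg (G : SimpleGraph (Fin n)) (ω : Fin n → ℕ) (t w : ℕ) :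
    Runs mainProg (inputState G ω t w) (160 * (n + 1) ^ 3 * (t + 1) ^ (t + 1))
      (IsCorrectAnswer G ω t w) := by
  refine Runs.seq (T₁ := 3) (Q := MainInv G ω t w 0)
    (T₂ := (t + 1) ^ t * (150 * (n + 1) ^ 3 * (t + 1) + 1) + 1 + 2) (.block le_rfl ?_) ?_ ?_
  · refine ⟨⟨?_, ?_, ?_, ?_, ?_, ?_⟩, ?_, ?_, ?_, by simp⟩
    iterate 6 simp [RamInstr.apply, inputState]
    -- The zero-initialised array `3` already holds the digits of 0.
    · funext i
      simp [RamInstr.apply, inputState, digit]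
    iterate 2 simp [RamInstr.apply, inputState]
  · have h1 : 1 ≤ (n + 1) ^ 3 := Nat.one_le_pow _ _ (by omega)
    have h2 : 1 ≤ (t + 1) ^ t := Nat.one_le_pow _ _ (by omega)
    have h3 : (t + 1) ^ t ≤ (t + 1) ^ (t + 1) := Nat.pow_le_pow_right (by omega) (by omega)
    calc _ = 150 * (n + 1) ^ 3 * (t + 1) ^ (t + 1) + ((t + 1) ^ t + 6) := by ring
      _ ≤ 150 * (n + 1) ^ 3 * (t + 1) ^ (t + 1) + 10 * (1 * (t + 1) ^ (t + 1)) := by omega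
      _ ≤ 150 * (n + 1) ^ 3 * (t + 1) ^ (t + 1) + 10 * ((n + 1) ^ 3 * (t + 1) ^ (t + 1)) := by
        gcongr
      _ = _ := by ring
  intro s hs
  refine Runs.seq (T₂ := 2) (Runs.while (N := (t + 1) ^ t) (I := MainInv G ω t w)
    (fun x hx s hs => ⟨by rw [hs.continue_eq]; exact one_ne_zero, runs_roundProg hs hx⟩)
    (pow_pos (Nat.succ_pos t) t) hs) le_rfl ?_
  rintro s₁ (⟨h28, h⟩ | ⟨h28, h⟩)
  · exact .block le_rfl (.inl ⟨by simp [RamInstr.apply, h28], h⟩)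
  · refine .block le_rfl (.inr ⟨by simp [RamInstr.apply, h28], ?_⟩)
    -- Completeness: any solution is traced by a path sequence that follows the digits of some `x`,
    -- and the search from its first vertex with that `x` has excluded it.
    rintro ⟨U, hU⟩
    obtain ⟨f, k, hf, rfl⟩ := hU.1.exists_isPathSeq
    obtain ⟨x, hx, hfol⟩ := hf.exists_follows hU.2.1
    exact h x hx (f 0) (f 0).2 f k rfl hf hU hfol

end Search

end SecludedPathProg

/-! ### The running time -/

theorem isBigO_logb_bound (C : ℝ) :
    (fun t : ℕ => C + ((t : ℝ) + 1) * Real.logb 2 ((t : ℝ) + 1)) =O[Filter.atTop]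
      fun t : ℕ => (t : ℝ) * Real.log (t : ℝ) := by
  have hlog2 : 0 < Real.log 2 := Real.log_pos one_lt_two
  refine Asymptotics.IsBigO.of_bound (|C| / Real.log 2 + 4 / Real.log 2) ?_
  filter_upwards [Filter.eventually_ge_atTop 2] with t ht
  have ht' : (2 : ℝ) ≤ t := by exact_mod_cast ht
  have hlog : Real.log 2 ≤ Real.log t := Real.log_le_log two_pos ht'
  -- For `t ≥ 2` one has `t + 1 ≤ t ^ 2` and `t + 1 ≤ 2 * t`; each bound contributes a factor 2 to
  -- the constant 4.
  have h1 : Real.log (t + 1) ≤ 2 * Real.log t := by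
    rw [← Real.log_rpow (by linarith)]
    refine Real.log_le_log (by linarith) ?_
    rw [Real.rpow_two]
    nlinarith
  have h0 : 0 ≤ Real.log ((t : ℝ) + 1) := Real.log_nonneg (by linarith)
  have hl0 : 0 ≤ (t : ℝ) * Real.log t := mul_nonneg (by linarith) (hlog2.le.trans hlog)
  rw [Real.norm_of_nonneg hl0, Real.logb, add_mul (|C| / _)]
  refine (norm_add_le _ _).trans (add_le_add ?_ ?_)
  · rw [Real.norm_eq_abs, div_mul_eq_mul_div, le_div_iff₀ hlog2]
    refine mul_le_mul_of_nonneg_left ?_ (abs_nonneg C)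
    nlinarith
  · rw [Real.norm_of_nonneg (by positivity), ← mul_div_assoc, div_mul_eq_mul_div]
    refine div_le_div_of_nonneg_right ?_ hlog2.le
    calc ((t : ℝ) + 1) * Real.log (t + 1) ≤ (2 * t) * (2 * Real.log t) := by
          gcongr
          linarith
      _ = _ := by ring

theorem mainTheorem7 :
    ∃ (p : RamProg) (g : ℕ → ℝ) (k : ℕ),
      g =O[Filter.atTop] (fun t : ℕ => (t : ℝ) * Real.log (t : ℝ)) ∧
      ∀ (n : ℕ) (G : SimpleGraph (Fin n)) (ω : Fin n → ℕ) (t w : ℕ),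
        (∀ v, 0 < ω v) → 0 < w →
        ∃ (T : ℕ) (s : RamState),
          RamExec p (inputState G ω t w) T s ∧
          IsCorrectAnswer G ω t w s ∧
          (T : ℝ) ≤ (2 : ℝ) ^ (g t) * ((n : ℝ) + 1) ^ k := by
  refine ⟨SecludedPathProg.mainProg,
    -- This exponent makes `2 ^ g t` equal to `160 * (t + 1) ^ (t + 1)`, the part of the step bound
    -- that does not depend on `n`.
    fun t => Real.logb 2 160 + ((t : ℝ) + 1) * Real.logb 2 ((t : ℝ) + 1), 3,
    isBigO_logb_bound _, fun n G ω t w _ _ => ?_⟩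
  obtain ⟨T, s, hT, he, hs⟩ := SecludedPathProg.runs_mainProg G ω t w
  refine ⟨T, s, he, hs, ?_⟩
  have hpow : (2 : ℝ) ^ (Real.logb 2 160 + ((t : ℝ) + 1) * Real.logb 2 ((t : ℝ) + 1)) =
      160 * ((t : ℝ) + 1) ^ (t + 1) := by
    rw [Real.rpow_add two_pos, Real.rpow_logb two_pos (by norm_num) (by norm_num), mul_comm (_ + 1),
      Real.rpow_mul two_pos.le, Real.rpow_logb two_pos (by norm_num) (by positivity)]
    norm_cast
  rw [hpow]
  calc (T : ℝ) ≤ ((160 * (n + 1) ^ 3 * (t + 1) ^ (t + 1) : ℕ) : ℝ) := by exact_mod_cast hT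
    _ = _ := by push_cast; ring
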